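/- **Setting.** Let $f_0,f_1$ be probability densities with respect to a $\sigma$-finite measure $\nu$ whose Kullback–Leibler divergences $I_0=\int\log(f_0/f_1)f_0\,d\nu$ and $I_1=\int\log(f_1/f_0)f_1\,d\nu$ are positive and finite. Let $X_1,X_2,\dots$ be i.i.d. with density $f_i$ under $\mathsf P_i$ ($i\in\{0,1\}$), $\mathcal F_n=\sigma(X_1,\dots,X_n)$, $\Lambda_n=\sum_{k=1}^n\log\frac{f_1(X_k)}{f_0(X_k)}$ and $\bar\Lambda_n=\Lambda_n/n$. A test is a pair $(T,D)$, where $T\ge1$ is an $(\mathcal F_n)$-stopping time, finite a.s. under $\mathsf P_0$ and $\mathsf P_1$, and $D\in\{0,1\}$ is $\mathcal F_T$-measurable; $D=1$ means that $H_0\colon f=f_0$ is rejected in favour of $H_1\colon f=f_1$. For $\alpha,\beta\in(0,1)$ let $\mathcal E(\alpha,\beta)$ be the set of tests with $\mathsf P_0(D=1)\le\alpha$ and $\mathsf P_1(D=0)\le\beta$. For $\pi\in[0,1]$ let $\mathsf E_\pi$ be the expectation under $(1-\pi)\mathsf P_0+\pi\mathsf P_1$ and $\mathcal L_\pi(\alpha,\beta)=\inf_{(T,D)\in\mathcal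 E(\alpha,\beta)}\mathsf E_\pi[T]$. **Many streams.** For each $m\ge1$ consider $m$ independent streams, i.i.d. with density $f_1$ for streams in the set of signals $\mathcal A\subseteq\{1,\dots,m\}$ and $f_0$ for the others; write $\mathsf P_{\mathcal A}$ for the law. The same test $(T,D)$ is applied to each stream $j$, giving $(T^j,D^j)$. Let $0\le l_m\le u_m\le m$, $u_m>0$, $l_m<m$, and let $\mathcal E_m(\alpha,\beta)$ be the set of tests such that $\mathsf P_{\mathcal A}(\exists j\notin\mathcal A: D^j=1)\le\alpha$ and $\mathsf P_{\mathcal A}(\exists j\in\mathcal A: D^j=0)\le\beta$ for all $\mathcal A$ with $l_m\le|\mathcal A|\le u_m$. Put $\alpha_m=1-(1-\alpha)^{1/(m-l_m)}$ and $\beta_m=1-(1-\beta)^{1/u_m}$. A family $\chi^*=\{(T^*(\alpha,\beta),D^*(\alpha,\beta)):\alpha,\beta\in(0,1)\}$ is *asymptotically optimal in the high-dimensional sense* if $(T^*(\alpha,\beta),D^*(\alpha,\beta))\in\mathcal E(\alpha,\beta)$ for all $\alpha,\beta\in(0,1)$ and, for all $\alpha,\beta\in(0,1)$, $$\max_{l_m\le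 s\le u_m}\frac{\mathsf E_{s/m}[T^*(\alpha_m,\beta_m)]}{\mathcal L_{s/m}(\alpha_m,\beta_m)}\longrightarrow1\qquad(m\to\infty).$$ **SPRTs.** For $\alpha,\beta\in(0,1)$, $\widetilde T(\alpha,\beta)=\inf\{n\ge1:\Lambda_n\notin(-|\log\beta|,|\log\alpha|)\}$ and $\widetilde D(\alpha,\beta)=1\{\Lambda_{\widetilde T}\ge|\log\alpha|\}$. **GMTs.** Let $n^*(a,b)$ be the least $n\ge1$ such that $\mathsf P_0(\bar\Lambda_n>c)\le a$ and $\mathsf P_1(\bar\Lambda_n\le c)\le b$ for some $c\in\mathbb R$, let $c^*(a,b)$ be the least such $c$ for $n=n^*(a,b)$, and let $\mathsf{FSST}(a,b)=(n^*(a,b),c^*(a,b))$. Given $\alpha,\beta\in(0,1)$, put $(N,C)=\mathsf{FSST}(\alpha/4,\beta/4)$, $$K_0=\max\{j\ge0: n^*((\beta/4)^j,(\beta/4)^j)\le N,\ (\beta/4)^j\ge3\alpha/4\},\qquad K_1=\max\{j\ge0: n^*((\alpha/4)^j,(\alpha/4)^j)\le N,\ (\alpha/4)^j\ge3\beta/4\},$$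 and, with free parameters $\gamma_0\in(\max(3\alpha,\beta)/4,1)$ and $\gamma_1\in(\max(\alpha,3\beta)/4,1)$, $$(N_{0,0},C_{0,0})=\mathsf{FSST}\Big(\gamma_0,\tfrac{3\beta}4-\sum_{j=1}^{K_0}(\tfrac\beta4)^j\Big),\qquad (N_{1,0},C_{1,0})=\mathsf{FSST}\Big(\tfrac{3\alpha}4-\sum_{j=1}^{K_1}(\tfrac\alpha4)^j,\gamma_1\Big),$$ $(N_{0,j},C_{0,j})=\mathsf{FSST}((\beta/4)^j,(\beta/4)^j)$ for $1\le j\le K_0$, and $(N_{1,j},C_{1,j})=\mathsf{FSST}((\alpha/4)^j,(\alpha/4)^j)$ for $1\le j\le K_1$. The GMT $(\widehat T(\alpha,\beta),\widehat D(\alpha,\beta))$ stops at the first of the following occasions: after $N_{0,j}<N$ observations with $\bar\Lambda_{N_{0,j}}\le C_{0,j}$, for some $0\le j\le K_0$, accepting $H_0$; after $N_{1,j}<N$ observations with $\bar\Lambda_{N_{1,j}}>C_{1,j}$, for some $0\le j\le K_1$, rejecting $H_0$; after $N$ observations, rejecting $H_0$ if and only if $\bar\Lambda_N>C$. The free parameters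 are functions $\gamma_0,\gamma_1$ of $(\alpha,\beta)$, with values in the above ranges, selected as follows. Write $\gamma_{0,0}=\gamma_0$, $\gamma_{0,j}=(\beta/4)^j$, $\gamma_{1,0}=\gamma_1$, $\gamma_{1,j}=(\alpha/4)^j$ for $j\ge1$, and $$U_i(\gamma_i)=N_{i,0}+\sum_{j=1}^{K_i}N_{i,j}\,\gamma_{i,j-1}+N\,\gamma_{i,K_i}.$$ For each $i\in\{0,1\}$: $\gamma_i(\alpha,\beta)$ minimizes $U_i$ over its range, except possibly for pairs $(\alpha,\beta)$ in some set (which may be empty, or consist of all pairs), and, as $\alpha,\beta\to0$ within that set, $\gamma_i\to0$ and $|\log\gamma_0|/|\log\beta|\to0$ (if $i=0$), respectively $|\log\gamma_1|/|\log\alpha|\to0$ (if $i=1$). **Statement.** Suppose that $u_m\to\infty$ and $m-l_m\to\infty$ as $m\to\infty$. Then: 1. for all $m\ge1$ and $\alpha,\beta\in(0,1)$, $\mathcal E_m(\alpha,\beta)=\mathcal E(\alpha_m,\beta_m)$, and $\frac1m\sum_{j=1}^m\mathsf E_{\mathcal A}[T^j]=\mathsf E_{|\mathcal A|/m}[T]$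 for every test $(T,D)$ and every $\mathcal A\subseteq\{1,\dots,m\}$, so that $\mathcal L_{s/m}(\alpha_m,\beta_m)$ is the optimal expected average sample size under familywise error control at levels $\alpha,\beta$ when there are $s$ signals, $l_m\le s\le u_m$; 2. the family of SPRTs is asymptotically optimal in the high-dimensional sense; 3. for every selection of the free parameters as above, the family of GMTs is asymptotically optimal in the high-dimensional sense. -/

import Mathlib

open MeasureTheory Filter Topology InformationTheory
open scoped ENNReal

noncomputable section

/-- The binary testing problem: two densities `f 0`, `f 1` with respect to a σ-finite measure `ν`,
both of whose Kullback-Leibler divergences are positive and finite. -/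
structure BinaryProblem (𝒳 : Type*) [MeasurableSpace 𝒳] where
  ν : Measure 𝒳
  sigmaFinite : SigmaFinite ν
  f : Fin 2 → 𝒳 → ℝ
  measurable_f : ∀ i, Measurable (f i)
  f_nonneg : ∀ i x, 0 ≤ f i x
  lintegral_f : ∀ i, ∫⁻ x, ENNReal.ofReal (f i x) ∂ν = 1
  kl_zero_pos : 0 < klDiv (ν.withDensity fun x => ENNReal.ofReal (f 0 x))
    (ν.withDensity fun x => ENNReal.ofReal (f 1 x))
  kl_zero_lt_top : klDiv (ν.withDensity fun x => ENNReal.ofReal (f 0 x))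
    (ν.withDensity fun x => ENNReal.ofReal (f 1 x)) < ⊤
  kl_one_pos : 0 < klDiv (ν.withDensity fun x => ENNReal.ofReal (f 1 x))
    (ν.withDensity fun x => ENNReal.ofReal (f 0 x))
  kl_one_lt_top : klDiv (ν.withDensity fun x => ENNReal.ofReal (f 1 x))
    (ν.withDensity fun x => ENNReal.ofReal (f 0 x)) < ⊤

/-- A sample size together with a decision, as functions of one data stream `ω`, whose `n`-th
observation is `ω (n - 1)`. The decision `1` rejects the null hypothesis. -/
structure TestRule (𝒳 : Type*) where
  T : (ℕ → 𝒳) → ℕ∞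
  D : (ℕ → 𝒳) → Fin 2

/-- The σ-algebra generated by the first `n` observations. -/
@[reducible] def obsSigma (𝒳 : Type*) [MeasurableSpace 𝒳] (n : ℕ) : MeasurableSpace (ℕ → 𝒳) :=
  MeasurableSpace.comap (fun (ω : ℕ → 𝒳) (k : Fin n) => ω k) MeasurableSpace.pi

/-- The type-I level `1 - (1 - α) ^ (1 / (m - l))` per stream. -/
def levelI (m l : ℕ) (α : ℝ) : ℝ := 1 - (1 - α) ^ (1 / ((m : ℝ) - (l : ℝ)))

/-- The type-II level `1 - (1 - β) ^ (1 / u)` per stream. -/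
def levelII (u : ℕ) (β : ℝ) : ℝ := 1 - (1 - β) ^ (1 / (u : ℝ))

namespace BinaryProblem

variable {𝒳 : Type*} [MeasurableSpace 𝒳] (B : BinaryProblem 𝒳)

/-- The law of one observation under `H i`. -/
def law (i : Fin 2) : Measure 𝒳 := B.ν.withDensity fun x => ENNReal.ofReal (B.f i x)

instance instIsProbabilityMeasureLaw (i : Fin 2) : IsProbabilityMeasure (B.law i) :=
  ⟨by rw [law, withDensity_apply _ MeasurableSet.univ, Measure.restrict_univ, B.lintegral_f i]⟩

/-- The law `P i` of the whole sequence of independent observations under `H i`. -/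
def P (i : Fin 2) : Measure (ℕ → 𝒳) := Measure.infinitePi fun _ : ℕ => B.law i

instance instIsProbabilityMeasureP (i : Fin 2) : IsProbabilityMeasure (B.P i) := by
  unfold P; infer_instance

/-- The log-likelihood ratio of the first `n` observations. -/
def LLR (n : ℕ) (ω : ℕ → 𝒳) : ℝ :=
  ∑ k ∈ Finset.range n, Real.log (B.f 1 (ω k) / B.f 0 (ω k))

/-- The average log-likelihood ratio of the first `n` observations. -/
def avgLLR (n : ℕ) (ω : ℕ → 𝒳) : ℝ := B.LLR n ω / n

/-! ### Tests and optimal expected sample sizes -/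

/-- Sequential tests: `T` is a stopping time with values in `{1, 2, …}`, finite almost surely under
both hypotheses, and `D` is determined by the observations up to `T`. -/
structure IsTest (τ : TestRule 𝒳) : Prop where
  one_le : ∀ ω, 1 ≤ τ.T ω
  stopping : ∀ n : ℕ, MeasurableSet[obsSigma 𝒳 n] {ω | τ.T ω = n}
  decision : ∀ (n : ℕ) (i : Fin 2), MeasurableSet[obsSigma 𝒳 n] {ω | τ.T ω = n ∧ τ.D ω = i}
  measurable_D : Measurable τ.D
  finite : ∀ i, ∀ᵐ ω ∂(B.P i), τ.T ω < ⊤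

/-- The tests with type-I and type-II error probabilities at most `α` and `β`. -/
def testClass (α β : ℝ) : Set (TestRule 𝒳) :=
  {τ | B.IsTest τ ∧ B.P 0 {ω | τ.D ω = 1} ≤ ENNReal.ofReal α ∧
    B.P 1 {ω | τ.D ω = 0} ≤ ENNReal.ofReal β}

/-- The mixture `(1 - π) P 0 + π P 1`. -/
def mixture (π : ℝ) : Measure (ℕ → 𝒳) :=
  ENNReal.ofReal (1 - π) • B.P 0 + ENNReal.ofReal π • B.P 1

/-- The expected sample size under the mixture with weight `π`. -/
def ess (π : ℝ) (τ : TestRule 𝒳) : ℝ≥0∞ := ∫⁻ ω, (τ.T ω : ℝ≥0∞) ∂(B.mixture π)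

/-- The optimal expected sample size under the mixture with weight `π`, among all tests with
error probabilities at most `α` and `β`. -/
def optESS (π α β : ℝ) : ℝ≥0∞ := ⨅ τ ∈ B.testClass α β, B.ess π τ

/-! ### Multiple streams -/

/-- The joint law of `m` independent streams when `A` is the set of signals. -/
def streamLaw (m : ℕ) (A : Finset (Fin m)) : Measure (Fin m → ℕ → 𝒳) :=
  Measure.pi fun j => B.P (if j ∈ A then 1 else 0)

/-- Familywise type-I error probability. -/
def fweI {m : ℕ} (A : Finset (Fin m)) (τ : TestRule 𝒳) : ℝ≥0∞ :=
  B.streamLaw m A {x | ∃ j, j ∉ A ∧ τ.D (x j) = 1}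

/-- Familywise type-II error probability. -/
def fweII {m : ℕ} (A : Finset (Fin m)) (τ : TestRule 𝒳) : ℝ≥0∞ :=
  B.streamLaw m A {x | ∃ j, j ∈ A ∧ τ.D (x j) = 0}

/-- The tests which, applied to each of `m` streams, control both familywise error probabilities
for every set of signals of size between `l` and `u`. -/
def fweClass (m l u : ℕ) (α β : ℝ) : Set (TestRule 𝒳) :=
  {τ | B.IsTest τ ∧ ∀ A : Finset (Fin m), l ≤ A.card → A.card ≤ u →
    B.fweI A τ ≤ ENNReal.ofReal α ∧ B.fweII A τ ≤ ENNReal.ofReal β}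

/-- The expected average sample size over `m` streams when `A` is the set of signals. -/
def avgESS {m : ℕ} (A : Finset (Fin m)) (τ : TestRule 𝒳) : ℝ≥0∞ :=
  (m : ℝ≥0∞)⁻¹ * ∑ j, ∫⁻ x, (τ.T (x j) : ℝ≥0∞) ∂(B.streamLaw m A)

/-- Asymptotic optimality in the high-dimensional sense of a family of tests, where `l m` and `u m`
bound the number of signals among `m` streams. -/
def HighDimOptimal (l u : ℕ → ℕ) (χ : ℝ → ℝ → TestRule 𝒳) : Prop :=
  (∀ α ∈ Set.Ioo (0 : ℝ) 1, ∀ β ∈ Set.Ioo (0 : ℝ) 1, χ α β ∈ B.testClass α β) ∧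
  ∀ α ∈ Set.Ioo (0 : ℝ) 1, ∀ β ∈ Set.Ioo (0 : ℝ) 1,
    Tendsto (fun m : ℕ => (Finset.Icc (l m) (u m)).sup fun s : ℕ =>
      B.ess ((s : ℝ) / m) (χ (levelI m (l m) α) (levelII (u m) β)) /
        B.optESS ((s : ℝ) / m) (levelI m (l m) α) (levelII (u m) β)) atTop (𝓝 1)

/-! ### The Sequential Probability Ratio Test -/

/-- The first `n ≥ 1` at which the log-likelihood ratio leaves `(-b, a)`; infinite if there is
none. -/
def sprtTime (a b : ℝ) (ω : ℕ → 𝒳) : ℕ∞ :=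
  sInf {t : ℕ∞ | ∃ n : ℕ, t = n ∧ 1 ≤ n ∧ B.LLR n ω ∉ Set.Ioo (-b) a}

open Classical in
/-- The SPRT with thresholds `|log α|` and `|log β|`. -/
def sprt (α β : ℝ) : TestRule 𝒳 where
  T := B.sprtTime |Real.log α| |Real.log β|
  D := fun ω => if ∃ n : ℕ, B.sprtTime |Real.log α| |Real.log β| ω = n ∧ |Real.log α| ≤ B.LLR n ω
    then 1 else 0

/-! ### The fixed-sample-size test -/

/-- Rejecting exactly when the average log-likelihood ratio of `n` observations exceeds `c` has
error probabilities at most `α` and `β`. -/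
def FixedOK (α β : ℝ) (n : ℕ) (c : ℝ) : Prop :=
  B.P 0 {ω | c < B.avgLLR n ω} ≤ ENNReal.ofReal α ∧
    B.P 1 {ω | B.avgLLR n ω ≤ c} ≤ ENNReal.ofReal β

/-- The smallest sample size of a fixed-sample-size test with error probabilities at most
`α`, `β`. -/
def nStar (α β : ℝ) : ℕ := sInf {n : ℕ | 1 ≤ n ∧ ∃ c : ℝ, B.FixedOK α β n c}

/-- The smallest threshold that goes with the sample size `nStar α β`. -/
def cStar (α β : ℝ) : ℝ := sInf {c : ℝ | B.FixedOK α β (B.nStar α β) c}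

end BinaryProblem

/-! ### The General Multistage Test -/

/-- The parameters of a General Multistage Test. For `j ≤ K i`, `N i j` and `C i j` are the sample
size and the threshold at the opportunity number `j` to select `H i`; `Nlast`, `Clast` are those of
the last stage. -/
structure GMTParams where
  K : Fin 2 → ℕ
  N : Fin 2 → ℕ → ℕ
  C : Fin 2 → ℕ → ℝ
  Nlast : ℕ
  Clast : ℝ

/-- The error probability `γ` at the first opportunity (`j = 0`), and `(x / 4) ^ j` at the
later ones. -/
def inactiveErr (γ x : ℝ) (j : ℕ) : ℝ := if j = 0 then γ else (x / 4) ^ j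

/-- The error probability `3 x / 4 - ∑ j = 1, …, K, (x / 4) ^ j` at the first opportunity (`j = 0`),
and `(x / 4) ^ j` at the later ones. -/
def activeErr (x : ℝ) (K j : ℕ) : ℝ :=
  if j = 0 then 3 * x / 4 - ∑ k ∈ Finset.Icc 1 K, (x / 4) ^ k else (x / 4) ^ j

namespace BinaryProblem

variable {𝒳 : Type*} [MeasurableSpace 𝒳] (B : BinaryProblem 𝒳)

/-- The test stops and accepts after `n` observations. Only stages before the last one count: the
thresholds of opportunities with sample size `Nlast` are ignored. -/
def gmtAccepts (p : GMTParams) (n : ℕ) (ω : ℕ → 𝒳) : Prop :=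
  ∃ j ≤ p.K 0, p.N 0 j = n ∧ n < p.Nlast ∧ B.avgLLR n ω ≤ p.C 0 j

/-- The test stops and rejects after `n` observations, before the last stage. -/
def gmtRejects (p : GMTParams) (n : ℕ) (ω : ℕ → 𝒳) : Prop :=
  ∃ j ≤ p.K 1, p.N 1 j = n ∧ n < p.Nlast ∧ p.C 1 j < B.avgLLR n ω

/-- The sample size of the General Multistage Test. -/
def gmtTime (p : GMTParams) (ω : ℕ → 𝒳) : ℕ :=
  sInf {n : ℕ | B.gmtAccepts p n ω ∨ B.gmtRejects p n ω ∨ n = p.Nlast}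

open Classical in
/-- The General Multistage Test with parameters `p`. -/
def gmtOf (p : GMTParams) : TestRule 𝒳 where
  T := fun ω => (B.gmtTime p ω : ℕ∞)
  D := fun ω =>
    if B.gmtRejects p (B.gmtTime p ω) ω ∨
      (B.gmtTime p ω = p.Nlast ∧ p.Clast < B.avgLLR p.Nlast ω) then 1 else 0

/-- The number of additional opportunities to accept (`i = 0`) or to reject (`i = 1`). -/
def gmtK (α β : ℝ) (i : Fin 2) : ℕ :=
  if i = 0 then
    sSup {j : ℕ | B.nStar ((β / 4) ^ j) ((β / 4) ^ j) ≤ B.nStar (α / 4) (β / 4) ∧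
      3 * α / 4 ≤ (β / 4) ^ j}
  else
    sSup {j : ℕ | B.nStar ((α / 4) ^ j) ((α / 4) ^ j) ≤ B.nStar (α / 4) (β / 4) ∧
      3 * β / 4 ≤ (α / 4) ^ j}

/-- The type-I and type-II levels of the fixed-sample-size test at the opportunity number `j` to
select `H i`, when the free parameter is `γ`. -/
def gmtErr (α β : ℝ) (i : Fin 2) (γ : ℝ) (j : ℕ) : ℝ × ℝ :=
  if i = 0 then (inactiveErr γ β j, activeErr β (B.gmtK α β 0) j)
  else (activeErr α (B.gmtK α β 1) j, inactiveErr γ α j)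

/-- The parameters of the proposed design, with free parameters `γ 0` and `γ 1`. -/
def gmtParams (α β : ℝ) (γ : Fin 2 → ℝ) : GMTParams where
  K := B.gmtK α β
  N := fun i j => B.nStar (B.gmtErr α β i (γ i) j).1 (B.gmtErr α β i (γ i) j).2
  C := fun i j => B.cStar (B.gmtErr α β i (γ i) j).1 (B.gmtErr α β i (γ i) j).2
  Nlast := B.nStar (α / 4) (β / 4)
  Clast := B.cStar (α / 4) (β / 4)

/-- The family of General Multistage Tests, for a selection `γ` of the free parameters. -/
def gmt (γ : Fin 2 → ℝ → ℝ → ℝ) (α β : ℝ) : TestRule 𝒳 :=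
  B.gmtOf (B.gmtParams α β fun i => γ i α β)

/-- The upper bound on the expected sample size under `P i`, as a function of the free
parameter. -/
def gmtBound (α β : ℝ) (i : Fin 2) (γ : ℝ) : ℝ :=
  let n : ℕ → ℝ := fun j => (B.nStar (B.gmtErr α β i γ j).1 (B.gmtErr α β i γ j).2 : ℝ)
  let g : ℕ → ℝ := inactiveErr γ (if i = 0 then β else α)
  n 0 + ∑ j ∈ Finset.Icc 1 (B.gmtK α β i), n j * g (j - 1) +
    (B.nStar (α / 4) (β / 4) : ℝ) * g (B.gmtK α β i)

/-- The range of the free parameter: `(max (3 α) β / 4, 1)` for `i = 0` and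
`(max α (3 β) / 4, 1)` for `i = 1`. -/
def gmtRange (α β : ℝ) (i : Fin 2) : Set ℝ :=
  if i = 0 then Set.Ioo (max (3 * α) β / 4) 1 else Set.Ioo (max α (3 * β) / 4) 1

/-- The pairs `(α, β)` at which the selected parameter does not minimize the bound on the expected
sample size under `P i`. -/
def gmtNonMin (i : Fin 2) (γ : ℝ → ℝ → ℝ) : Set (ℝ × ℝ) :=
  {q | ¬ IsMinOn (B.gmtBound q.1 q.2 i) (gmtRange q.1 q.2 i) (γ q.1 q.2)}

/-- Admissible selections of the free parameter for `i`: at each `(α, β)` the parameter lies in its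
range, and it minimizes the bound, except possibly at a set of pairs `(α, β)` along which, as
`α, β → 0`, it vanishes while its logarithm is negligible relative to `|log β|` (for `i = 0`) or
`|log α|` (for `i = 1`). The set of exceptional pairs may be empty (minimizers everywhere), and it
may consist of all pairs. -/
def GMTSelection (i : Fin 2) (γ : ℝ → ℝ → ℝ) : Prop :=
  (∀ α ∈ Set.Ioo (0 : ℝ) 1, ∀ β ∈ Set.Ioo (0 : ℝ) 1, γ α β ∈ gmtRange α β i) ∧
  Tendsto (fun q : ℝ × ℝ => γ q.1 q.2)
    ((𝓝[>] (0 : ℝ) ×ˢ 𝓝[>] (0 : ℝ)) ⊓ 𝓟 (B.gmtNonMin i γ)) (𝓝 0) ∧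
  Tendsto (fun q : ℝ × ℝ => |Real.log (γ q.1 q.2)| / |Real.log (if i = 0 then q.2 else q.1)|)
    ((𝓝[>] (0 : ℝ) ×ˢ 𝓝[>] (0 : ℝ)) ⊓ 𝓟 (B.gmtNonMin i γ)) (𝓝 0)

end BinaryProblem

end

/-! Independence of the streams turns a familywise error probability into 1 - (1 - p)^N, where p is
the error probability in one stream and N counts the streams at risk. It is largest for N = m - l_m
(type I) and N = u_m (type II), so familywise control is exactly control at α_m and β_m in one
stream. These levels vanish at unrelated rates, so all asymptotics are taken as (α, β) → (0, 0)
along a product filter.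

An expected sample size under a mixture is the mixture of those under P_0 and P_1. Every test in
E(α, β) needs at least (1 - o(1)) |log β| / I_0 observations on average under P_0 and (1 - o(1))
|log α| / I_1 under P_1. A family attaining both bounds is therefore optimal uniformly in the mixing
weight (`highDimOptimal_of_eventually`). The lower bound (`eventually_le_lintegral`) is a change of
measure: accepting with a log-likelihood ratio of at least -a has P_0-probability at most e^a β, and
by the law of large numbers the ratio is unlikely to fall below -cn within n observations if c >
I_0.

For the SPRT the upper bound is Wald's identity with increments truncated from above, which bounds
the overshoot without second moments (`lintegral_stopping_le`).

For the GMT the error control is a union bound, and the expected sample size is at most U_i.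
Chernoff's bound yields n*(a, b) ≤ max(|log b| / (I_0 - δ), |log a| / r) + 1
(`exists_nStar_le_zero`). Hence the first opportunity costs about |log β| / I_0 once |log γ_0| =
o(|log β|); a later opportunity j has sample size O(j |log β|), weighted by the small probability of
a failure at opportunity j - 1; and the maximality of K_0 forces N = O((K_0 + 1) |log β|). These
terms sum to O((γ_0 + β) |log β|) (`stageBound_le`). A minimizing parameter does at least as well as
the explicit choice max(α, 1 / |log β|) (`eventually_bound_le`). Exchanging the hypotheses gives the
case of P_1. -/

noncomputable section

namespace BinaryProblem

/-! ### The likelihood ratio of one observation -/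

variable {𝒳 : Type*} [MeasurableSpace 𝒳] (B : BinaryProblem 𝒳)

/-- The testing problem with the two hypotheses exchanged. -/
def swap : BinaryProblem 𝒳 where
  ν := B.ν
  sigmaFinite := B.sigmaFinite
  f := ![B.f 1, B.f 0]
  measurable_f := Fin.forall_fin_two.2 ⟨B.measurable_f 1, B.measurable_f 0⟩
  f_nonneg := Fin.forall_fin_two.2 ⟨B.f_nonneg 1, B.f_nonneg 0⟩
  lintegral_f := Fin.forall_fin_two.2 ⟨B.lintegral_f 1, B.lintegral_f 0⟩
  kl_zero_pos := by simpa using B.kl_one_pos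
  kl_zero_lt_top := by simpa using B.kl_one_lt_top
  kl_one_pos := by simpa using B.kl_zero_pos
  kl_one_lt_top := by simpa using B.kl_zero_lt_top

/-- The log-likelihood ratio of one observation. -/
def logLR (x : 𝒳) : ℝ := Real.log (B.f 1 x / B.f 0 x)

/-- The Kullback-Leibler divergence of `f 0` from `f 1`. -/
def info : ℝ := ∫ x, -B.logLR x ∂(B.law 0)

lemma swap_P_zero : B.swap.P 0 = B.P 1 := rfl
lemma swap_P_one : B.swap.P 1 = B.P 0 := rfl

lemma swap_logLR (x : 𝒳) : B.swap.logLR x = -B.logLR x := by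
  change Real.log (B.f 0 x / B.f 1 x) = -Real.log (B.f 1 x / B.f 0 x)
  rw [← Real.log_inv, inv_div]

lemma LLR_eq (n : ℕ) (ω : ℕ → 𝒳) : B.LLR n ω = ∑ k ∈ Finset.range n, B.logLR (ω k) := rfl

lemma swap_LLR (n : ℕ) (ω : ℕ → 𝒳) : B.swap.LLR n ω = -B.LLR n ω := by
  simp [LLR_eq, swap_logLR]

lemma swap_avgLLR (n : ℕ) (ω : ℕ → 𝒳) : B.swap.avgLLR n ω = -B.avgLLR n ω := by
  simp [avgLLR, swap_LLR, neg_div]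

lemma measurable_logLR : Measurable B.logLR :=
  Real.measurable_log.comp ((B.measurable_f 1).div (B.measurable_f 0))

lemma measurable_LLR (n : ℕ) : Measurable (B.LLR n) :=
  Finset.measurable_sum _ fun k _ => B.measurable_logLR.comp (measurable_pi_apply k)

lemma measurable_avgLLR (n : ℕ) : Measurable (B.avgLLR n) := (B.measurable_LLR n).div_const _

lemma law_zero_absolutelyContinuous : B.law 0 ≪ B.law 1 :=
  (klDiv_ne_top_iff.1 B.kl_zero_lt_top.ne).1

lemma law_one_absolutelyContinuous : B.law 1 ≪ B.law 0 :=
  (klDiv_ne_top_iff.1 B.kl_one_lt_top.ne).1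

lemma ae_law_pos (i : Fin 2) : ∀ᵐ x ∂(B.law i), 0 < B.f i x := by
  rw [law, ae_withDensity_iff (B.measurable_f i).ennreal_ofReal]
  exact Eventually.of_forall fun x hx => by simpa using hx

lemma ae_pos_zero : ∀ᵐ x ∂(B.law 0), 0 < B.f 0 x ∧ 0 < B.f 1 x :=
  (B.ae_law_pos 0).and (B.law_zero_absolutelyContinuous.ae_le (B.ae_law_pos 1))

/-- Finite divergence makes the two laws mutually absolutely continuous, so the points where `f 0`
vanishes but `f 1` does not are negligible. -/
lemma law_zero_withDensity :
    (B.law 0).withDensity (fun x => ENNReal.ofReal (B.f 1 x / B.f 0 x)) = B.law 1 := by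
  have hm : Measurable fun x => ENNReal.ofReal (B.f 1 x / B.f 0 x) :=
    ((B.measurable_f 1).div (B.measurable_f 0)).ennreal_ofReal
  rw [law, ← withDensity_mul _ (B.measurable_f 0).ennreal_ofReal hm, law]
  have h : ∀ᵐ x ∂B.ν, 0 < B.f 1 x → 0 < B.f 0 x := by
    have : ∀ᵐ x ∂(B.law 1), 0 < B.f 0 x :=
      B.law_one_absolutelyContinuous.ae_le (B.ae_law_pos 0)
    rw [law, ae_withDensity_iff (B.measurable_f 1).ennreal_ofReal] at this
    filter_upwards [this] with x hx h1
    exact hx (by simpa using h1)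
  refine withDensity_congr_ae ?_
  filter_upwards [h] with x hx
  rw [Pi.mul_apply, ← ENNReal.ofReal_mul (B.f_nonneg 0 x)]
  rcases (B.f_nonneg 1 x).eq_or_lt with h1 | h1
  · simp [← h1]
  · rw [mul_div_cancel₀ _ (hx h1).ne']

/-- Only almost everywhere: where a density vanishes, the conventions for division and `Real.log`
give `logLR` the value 0. -/
lemma exp_logLR_ae : ∀ᵐ x ∂(B.law 0), Real.exp (B.logLR x) = B.f 1 x / B.f 0 x := by
  filter_upwards [B.ae_pos_zero] with x hx
  exact Real.exp_log (div_pos hx.2 hx.1)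

lemma law_zero_withDensity_exp :
    (B.law 0).withDensity (fun x => ENNReal.ofReal (Real.exp (B.logLR x))) = B.law 1 := by
  rw [← B.law_zero_withDensity]
  refine withDensity_congr_ae ?_
  filter_upwards [B.exp_logLR_ae] with x hx
  rw [hx]

lemma llr_law_one_zero : llr (B.law 1) (B.law 0) =ᵐ[B.law 0] B.logLR := by
  have h := Measure.rnDeriv_withDensity (B.law 0)
    (B.measurable_logLR.exp.ennreal_ofReal)
  rw [B.law_zero_withDensity_exp] at h
  filter_upwards [h] with x hx
  rw [llr, hx, ENNReal.toReal_ofReal (Real.exp_pos _).le, Real.log_exp]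

lemma llr_law_zero_one : llr (B.law 0) (B.law 1) =ᵐ[B.law 0] fun x => -B.logLR x := by
  have h := B.law_zero_absolutelyContinuous.ae_le B.swap.llr_law_one_zero
  filter_upwards [h] with x hx
  rw [← B.swap_logLR]
  exact hx

lemma integrable_logLR : Integrable B.logLR (B.law 0) := by
  have h := (klDiv_ne_top_iff.1 B.kl_zero_lt_top.ne).2
  have h2 : Integrable (fun x => -B.logLR x) (B.law 0) := h.congr B.llr_law_zero_one
  simpa using h2.neg

lemma info_pos : 0 < B.info := by
  have h : B.law 0 ≪ B.law 1 ∧ Integrable (llr (B.law 0) (B.law 1)) (B.law 0) :=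
    klDiv_ne_top_iff.1 B.kl_zero_lt_top.ne
  have h2 : (klDiv (B.law 0) (B.law 1)).toReal = B.info := by
    rw [toReal_klDiv_of_measure_eq h.1 (by simp), info]
    exact integral_congr_ae B.llr_law_zero_one
  rw [← h2]
  exact ENNReal.toReal_pos B.kl_zero_pos.ne' B.kl_zero_lt_top.ne

lemma lintegral_exp_logLR : ∫⁻ x, ENNReal.ofReal (Real.exp (B.logLR x)) ∂(B.law 0) = 1 := by
  rw [← setLIntegral_univ, ← withDensity_apply _ MeasurableSet.univ, B.law_zero_withDensity_exp,
    measure_univ]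

lemma integrable_exp_logLR : Integrable (fun x => Real.exp (B.logLR x)) (B.law 0) := by
  refine ⟨B.measurable_logLR.exp.aestronglyMeasurable, ?_⟩
  rw [hasFiniteIntegral_iff_ofReal (Eventually.of_forall fun x => (Real.exp_pos _).le),
    B.lintegral_exp_logLR]
  exact ENNReal.one_lt_top

/-! ### Coordinates and change of measure -/

lemma measurePreserving_eval (i : Fin 2) (k : ℕ) :
    MeasurePreserving (fun ω : ℕ → 𝒳 => ω k) (B.P i) (B.law i) :=
  measurePreserving_eval_infinitePi (fun _ : ℕ => B.law i) k

lemma iIndepFun_eval (i : Fin 2) : ProbabilityTheory.iIndepFun (fun k (ω : ℕ → 𝒳) => ω k) (B.P i) := by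
  exact ProbabilityTheory.iIndepFun_infinitePi (P := fun _ : ℕ => B.law i)
    (X := fun _ x => x) (fun _ => measurable_id)

lemma measurable_firstObs (n : ℕ) : Measurable fun (ω : ℕ → 𝒳) (k : Fin n) => ω k :=
  measurable_pi_lambda _ fun _ => measurable_pi_apply _

lemma obsSigma_le (n : ℕ) : obsSigma 𝒳 n ≤ MeasurableSpace.pi :=
  (measurable_firstObs n).comap_le

lemma map_firstObs (i : Fin 2) (n : ℕ) :
    (B.P i).map (fun (ω : ℕ → 𝒳) (k : Fin n) => ω k) = Measure.pi fun _ : Fin n => B.law i := by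
  have h := ((B.iIndepFun_eval i).precomp (g := fun k : Fin n => (k : ℕ)) Fin.val_injective)
  rw [ProbabilityTheory.iIndepFun_iff_map_fun_eq_pi_map
    (fun k => (measurable_pi_apply _).aemeasurable)] at h
  rw [h]
  congr 1
  ext1 k
  exact (B.measurePreserving_eval i k).map_eq

/-- Both measures agree on boxes, where the integral of the product factorizes by independence of
the coordinates. -/
lemma pi_withDensity {n : ℕ} (μ : Measure 𝒳) [IsProbabilityMeasure μ] {g : 𝒳 → ℝ≥0∞}
    (hg : Measurable g) [SigmaFinite (μ.withDensity g)] :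
    (Measure.pi fun _ : Fin n => μ).withDensity (fun x => ∏ k, g (x k)) =
      Measure.pi fun _ : Fin n => μ.withDensity g := by
  refine (Measure.pi_eq fun s hs => ?_).symm
  rw [withDensity_apply _ (MeasurableSet.univ_pi hs), ← lintegral_indicator (MeasurableSet.univ_pi hs)]
  have h1 : ∀ x : Fin n → 𝒳, (Set.univ.pi s).indicator (fun x => ∏ k, g (x k)) x =
      ∏ k, (s k).indicator g (x k) := by
    intro x
    by_cases hx : x ∈ Set.univ.pi s
    · rw [Set.indicator_of_mem hx]
      exact Finset.prod_congr rfl fun k _ => (Set.indicator_of_mem (hx k (Set.mem_univ k)) _).symm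
    · rw [Set.indicator_of_notMem hx]
      simp only [Set.mem_univ_pi, not_forall] at hx
      obtain ⟨k, hk⟩ := hx
      exact (Finset.prod_eq_zero (Finset.mem_univ k) (Set.indicator_of_notMem hk _)).symm
  simp_rw [h1]
  have hm : ∀ k : Fin n, Measurable fun x : Fin n → 𝒳 => (s k).indicator g (x k) := fun k =>
    (hg.indicator (hs k)).comp (measurable_pi_apply k)
  have hind : ProbabilityTheory.iIndepFun (fun (k : Fin n) (x : Fin n → 𝒳) => (s k).indicator g (x k))
      (Measure.pi fun _ : Fin n => μ) :=
    ProbabilityTheory.iIndepFun_pi (X := fun k => (s k).indicator g)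
      fun k => (hg.indicator (hs k)).aemeasurable
  rw [ProbabilityTheory.lintegral_prod_eq_prod_lintegral_of_indepFun _ _ hind hm]
  refine Finset.prod_congr rfl fun k _ => ?_
  rw [withDensity_apply _ (hs k), ← lintegral_indicator (hs k)]
  exact (MeasureTheory.measurePreserving_eval (fun _ : Fin n => μ) k).lintegral_comp (hg.indicator (hs k))

/-- Change of measure on the σ-algebra of the first `n` observations. -/
lemma P_one_eq_setLIntegral {n : ℕ} {E : Set (ℕ → 𝒳)} (hE : MeasurableSet[obsSigma 𝒳 n] E) :
    B.P 1 E = ∫⁻ ω in E, ENNReal.ofReal (Real.exp (B.LLR n ω)) ∂(B.P 0) := by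
  obtain ⟨s, hs, rfl⟩ := hE
  have hm := measurable_firstObs (𝒳 := 𝒳) n
  have hg : Measurable fun x => ENNReal.ofReal (Real.exp (B.logLR x)) :=
    B.measurable_logLR.exp.ennreal_ofReal
  have : SigmaFinite ((B.law 0).withDensity fun x => ENNReal.ofReal (Real.exp (B.logLR x))) := by
    rw [B.law_zero_withDensity_exp]; infer_instance
  have hG : Measurable fun x : Fin n → 𝒳 => ∏ k, ENNReal.ofReal (Real.exp (B.logLR (x k))) :=
    Finset.measurable_prod _ fun k _ => hg.comp (measurable_pi_apply k)
  rw [← Measure.map_apply hm hs, B.map_firstObs 1 n, ← B.law_zero_withDensity_exp,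
    ← pi_withDensity _ hg, withDensity_apply _ hs, ← B.map_firstObs 0 n, setLIntegral_map hs hG hm]
  refine lintegral_congr fun ω => ?_
  rw [LLR_eq, Real.exp_sum, ENNReal.ofReal_prod_of_nonneg fun k _ => (Real.exp_pos _).le]
  exact Fin.prod_univ_eq_prod_range (fun k => ENNReal.ofReal (Real.exp (B.logLR (ω k)))) n

/-- The density of `P 1` with respect to `P 0` is at least `exp a` on `E`. -/
lemma P_zero_le_of_le_LLR {n : ℕ} {E : Set (ℕ → 𝒳)} (hE : MeasurableSet[obsSigma 𝒳 n] E) {a : ℝ}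
    (h : ∀ ω ∈ E, a ≤ B.LLR n ω) : B.P 0 E ≤ ENNReal.ofReal (Real.exp (-a)) * B.P 1 E := by
  rw [B.P_one_eq_setLIntegral hE]
  calc B.P 0 E = ENNReal.ofReal (Real.exp (-a)) *
        ∫⁻ _ in E, ENNReal.ofReal (Real.exp a) ∂(B.P 0) := by
        rw [setLIntegral_const, ← mul_assoc, ← ENNReal.ofReal_mul (Real.exp_pos _).le,
          ← Real.exp_add]
        simp
    _ ≤ _ := by
        gcongr 1
        exact setLIntegral_mono' (obsSigma_le n _ hE) fun ω hω =>
          ENNReal.ofReal_le_ofReal (Real.exp_le_exp.2 (h ω hω))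

/-- Change of measure at a stopping time: `E n` is to be a part of the event that the time equals
`n`, so the pieces can be treated separately and summed. -/
lemma P_zero_iUnion_le {E : ℕ → Set (ℕ → 𝒳)} (hE : ∀ n, MeasurableSet[obsSigma 𝒳 n] (E n))
    (hd : Pairwise (Function.onFun Disjoint E)) {a : ℝ} (h : ∀ n, ∀ ω ∈ E n, a ≤ B.LLR n ω) :
    B.P 0 (⋃ n, E n) ≤ ENNReal.ofReal (Real.exp (-a)) * B.P 1 (⋃ n, E n) := by
  rw [measure_iUnion hd fun n => obsSigma_le n _ (hE n),
    measure_iUnion hd fun n => obsSigma_le n _ (hE n), ← ENNReal.tsum_mul_left]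
  exact ENNReal.tsum_le_tsum fun n => B.P_zero_le_of_le_LLR (hE n) (h n)

/-! ### Measurability with respect to the first observations -/

lemma obsSigma_mono {m n : ℕ} (h : m ≤ n) : obsSigma 𝒳 m ≤ obsSigma 𝒳 n := by
  rintro s ⟨t, ht, rfl⟩
  refine ⟨(fun (x : Fin n → 𝒳) (k : Fin m) => x (Fin.castLE h k)) ⁻¹' t, ?_, rfl⟩
  exact (measurable_pi_lambda _ fun k => measurable_pi_apply _) ht

lemma measurable_LLR_obsSigma {m n : ℕ} (h : m ≤ n) : Measurable[obsSigma 𝒳 n] (B.LLR m) := by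
  have h1 : Measurable[obsSigma 𝒳 n] fun (ω : ℕ → 𝒳) (k : Fin n) => ω k :=
    comap_measurable _
  have h2 : Measurable fun x : Fin n → 𝒳 =>
      ∑ k ∈ Finset.range m, if hk : k < n then B.logLR (x ⟨k, hk⟩) else 0 := by
    refine Finset.measurable_sum _ fun k _ => ?_
    split_ifs with hk
    · exact B.measurable_logLR.comp (measurable_pi_apply _)
    · exact measurable_const
  have h3 := h2.comp h1
  convert h3 using 1
  ext ω
  simp only [LLR_eq, Function.comp]
  refine Finset.sum_congr rfl fun k hk => ?_
  rw [dif_pos ((Finset.mem_range.1 hk).trans_le h)]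

lemma measurable_avgLLR_obsSigma {m n : ℕ} (h : m ≤ n) : Measurable[obsSigma 𝒳 n] (B.avgLLR m) :=
  (B.measurable_LLR_obsSigma h).div_const _

/-! ### Stopping times -/

/-- Stopping times of the observations. -/
def IsStopping (T : (ℕ → 𝒳) → ℕ∞) : Prop := ∀ n : ℕ, MeasurableSet[obsSigma 𝒳 n] {ω | T ω = n}

lemma IsStopping.measurable {T : (ℕ → 𝒳) → ℕ∞} (hT : IsStopping T) : Measurable T := by
  have h1 : ∀ n : ℕ, MeasurableSet (T ⁻¹' {(n : ℕ∞)}) := fun n => obsSigma_le n _ (hT n)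
  refine measurable_to_countable' fun x => ?_
  induction x using ENat.recTopCoe with
  | coe n => exact h1 n
  | top =>
    have : T ⁻¹' {⊤} = (⋃ n : ℕ, T ⁻¹' {(n : ℕ∞)})ᶜ := by
      ext ω
      simp only [Set.mem_preimage, Set.mem_singleton_iff, Set.mem_compl_iff, Set.mem_iUnion,
        not_exists]
      refine ⟨fun h n => by simp [h], fun h => ?_⟩
      by_contra hne
      obtain ⟨n, hn⟩ := ENat.ne_top_iff_exists.1 hne
      exact h n hn.symm
    rw [this]
    exact (MeasurableSet.iUnion h1).compl

lemma IsStopping.measurableSet_lt {T : (ℕ → 𝒳) → ℕ∞} (hT : IsStopping T) (k : ℕ) :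
    MeasurableSet[obsSigma 𝒳 k] {ω | (k : ℕ∞) < T ω} := by
  have : {ω | (k : ℕ∞) < T ω} = (⋃ j ∈ Finset.range (k + 1), {ω | T ω = j})ᶜ := by
    ext ω
    simp only [Set.mem_ofPred_eq, Finset.mem_range, Set.mem_compl_iff, Set.mem_iUnion, not_exists]
    refine ⟨fun h j hj hTj => ?_, fun h => ?_⟩
    · rw [hTj] at h
      exact absurd (Nat.cast_lt.1 h) (by omega)
    · by_contra hle
      rw [not_lt] at hle
      obtain ⟨j, hj⟩ := ENat.ne_top_iff_exists.1 (ne_top_of_le_ne_top (ENat.natCast_ne_top k) hle)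
      rw [← hj] at hle
      exact h j (Nat.lt_succ_of_le (Nat.cast_le.1 hle)) hj.symm
  rw [this]
  refine MeasurableSet.compl ?_
  exact Finset.measurableSet_biUnion _ fun j hj =>
    obsSigma_mono (Nat.lt_succ_iff.1 (Finset.mem_range.1 hj)) _ (hT j)

lemma toENNReal_eq_tsum (t : ℕ∞) :
    (t : ℝ≥0∞) = ∑' k : ℕ, if (k : ℕ∞) < t then (1 : ℝ≥0∞) else 0 := by
  induction t using ENat.recTopCoe with
  | top => simp
  | coe n =>
    rw [tsum_eq_sum (s := Finset.range n)]
    · rw [Finset.sum_congr rfl fun k hk => if_pos (Nat.cast_lt.2 (Finset.mem_range.1 hk))]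
      simp
    · intro k hk
      rw [if_neg]
      simpa using hk

lemma measurable_toENNReal {T : (ℕ → 𝒳) → ℕ∞} (hT : Measurable T) :
    Measurable fun ω => (T ω : ℝ≥0∞) :=
  (measurable_from_top (f := fun t : ℕ∞ => (t : ℝ≥0∞))).comp hT

lemma IsStopping.lintegral_eq_tsum {T : (ℕ → 𝒳) → ℕ∞} (hT : IsStopping T)
    (μ : Measure (ℕ → 𝒳)) : ∫⁻ ω, (T ω : ℝ≥0∞) ∂μ = ∑' k : ℕ, μ {ω | (k : ℕ∞) < T ω} := by
  have hm : ∀ k : ℕ, MeasurableSet {ω | (k : ℕ∞) < T ω} := fun k =>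
    obsSigma_le k _ (hT.measurableSet_lt k)
  simp_rw [toENNReal_eq_tsum]
  rw [lintegral_tsum fun k =>
    (Measurable.ite (hm k) measurable_const measurable_const).aemeasurable]
  refine tsum_congr fun k => ?_
  rw [← lintegral_indicator_one (hm k)]
  simp only [Set.indicator_apply, Set.mem_ofPred_eq, Pi.one_apply]

/-! ### Wald's identity and the upper bound on the expected exit time -/

/-- The drift towards `H 0`, for increments truncated at `M`. -/
def truncInfo (M : ℝ) : ℝ := ∫ x, min (-B.logLR x) M ∂(B.law 0)

lemma integrable_min (M : ℝ) : Integrable (fun x => min (-B.logLR x) M) (B.law 0) :=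
  B.integrable_logLR.neg.inf (integrable_const M)

/-- Dominated convergence: truncating the increments costs arbitrarily little drift. -/
lemma exists_truncInfo_gt {c : ℝ} (hc : c < B.info) : ∃ M, 0 ≤ M ∧ c < B.truncInfo M := by
  have h : Tendsto (fun n : ℕ => B.truncInfo n) atTop (𝓝 B.info) := by
    refine tendsto_integral_of_dominated_convergence (fun x => |B.logLR x|)
      (fun n => (B.integrable_min n).aestronglyMeasurable) B.integrable_logLR.abs
      (fun n => Eventually.of_forall fun x => ?_) (Eventually.of_forall fun x => ?_)
    · rw [Real.norm_eq_abs, abs_le]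
      constructor
      · refine le_min ?_ ?_
        · linarith [le_abs_self (B.logLR x)]
        · linarith [abs_nonneg (B.logLR x), (Nat.cast_nonneg n : (0 : ℝ) ≤ n)]
      · exact (min_le_left _ _).trans (neg_le_abs _)
    · obtain ⟨n, hn⟩ := exists_nat_ge (-B.logLR x)
      refine tendsto_const_nhds.congr' ?_
      filter_upwards [eventually_ge_atTop n] with m hm
      rw [min_eq_left (hn.trans (Nat.cast_le.2 hm))]
  obtain ⟨n, hn⟩ := (h.eventually (lt_mem_nhds hc)).exists
  exact ⟨n, Nat.cast_nonneg n, hn⟩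

/-- The first `k` observations are the coordinates below `k`; coordinate `k` is the next one. With
`S` the event `k < T`, this is what Wald's identity needs. -/
lemma indepFun_indicator_eval (i : Fin 2) {k : ℕ} {S : Set (ℕ → 𝒳)}
    (hS : MeasurableSet[obsSigma 𝒳 k] S) {Y : 𝒳 → ℝ} (hY : Measurable Y) :
    ProbabilityTheory.IndepFun (S.indicator fun _ => (1 : ℝ)) (fun ω => Y (ω k)) (B.P i) := by
  obtain ⟨s, hs, rfl⟩ := hS
  have h := (B.iIndepFun_eval i).indepFun_finset (Finset.range k) {k} (by simp)
    fun j => measurable_pi_apply j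
  have hφ : Measurable fun x : Finset.range k → 𝒳 =>
      s.indicator (fun _ => (1 : ℝ)) fun j : Fin k => x ⟨j, Finset.mem_range.2 j.2⟩ :=
    (measurable_const.indicator hs).comp (measurable_pi_lambda _ fun j => measurable_pi_apply _)
  have hψ : Measurable fun x : ({k} : Finset ℕ) → 𝒳 => Y (x ⟨k, Finset.mem_singleton_self k⟩) :=
    hY.comp (measurable_pi_apply _)
  exact h.comp hφ hψ

lemma integral_indicator_mul_eval {k : ℕ} {S : Set (ℕ → 𝒳)}
    (hS : MeasurableSet[obsSigma 𝒳 k] S) {Y : 𝒳 → ℝ} (hY : Measurable Y) :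
    ∫ ω, S.indicator (fun _ => (1 : ℝ)) ω * Y (ω k) ∂(B.P 0) =
      (B.P 0).real S * ∫ x, Y x ∂(B.law 0) := by
  have hSm := obsSigma_le k _ hS
  rw [(B.indepFun_indicator_eval 0 hS hY).integral_fun_mul_eq_mul_integral
    (measurable_const.indicator hSm).aestronglyMeasurable
    (hY.comp (measurable_pi_apply k)).aestronglyMeasurable]
  congr 1
  · rw [integral_indicator hSm]
    simp
  · rw [← (B.measurePreserving_eval 0 k).map_eq]
    exact (integral_map (measurable_pi_apply k).aemeasurable hY.aestronglyMeasurable).symm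

/-- Before the last increment the sum is still at most `b`, and one truncated increment adds at most
`M`. -/
lemma sum_indicator_min_le {T : (ℕ → 𝒳) → ℕ∞} {b M : ℝ} (hb : 0 ≤ b) (hM : 0 ≤ M)
    (hT : ∀ ω, ∀ n : ℕ, (n : ℕ∞) < T ω → -B.LLR n ω ≤ b) (n : ℕ) (ω : ℕ → 𝒳) :
    ∑ k ∈ Finset.range n, {ω | (k : ℕ∞) < T ω}.indicator (fun _ => (1 : ℝ)) ω *
      min (-B.logLR (ω k)) M ≤ b + M := by
  induction n with
  | zero => simpa using add_nonneg hb hM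
  | succ n ih =>
    rw [Finset.sum_range_succ]
    by_cases h : (n : ℕ∞) < T ω
    · have h1 : ∑ k ∈ Finset.range n, {ω | (k : ℕ∞) < T ω}.indicator (fun _ => (1 : ℝ)) ω *
          min (-B.logLR (ω k)) M ≤ -B.LLR n ω := by
        rw [LLR_eq, ← Finset.sum_neg_distrib]
        refine Finset.sum_le_sum fun k hk => ?_
        have hk' : (k : ℕ∞) < T ω := lt_trans (Nat.cast_lt.2 (Finset.mem_range.1 hk)) h
        rw [Set.indicator_of_mem (by exact hk'), one_mul]
        exact min_le_left _ _
      rw [Set.indicator_of_mem (by exact h), one_mul]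
      exact add_le_add (h1.trans (hT ω n h)) (min_le_right _ _)
    · rw [Set.indicator_of_notMem (by exact h), zero_mul, add_zero]
      exact ih

/-- A stopping time that ends at the latest when `-LLR` exceeds `b` has expectation
at most `(b + M) / truncInfo M` under `P 0`. -/
lemma lintegral_stopping_le {T : (ℕ → 𝒳) → ℕ∞} (hT : IsStopping T) {b M : ℝ} (hb : 0 ≤ b)
    (hM : 0 ≤ M) (hTb : ∀ ω, ∀ n : ℕ, (n : ℕ∞) < T ω → -B.LLR n ω ≤ b) (hμ : 0 < B.truncInfo M) :
    ∫⁻ ω, (T ω : ℝ≥0∞) ∂(B.P 0) ≤ ENNReal.ofReal ((b + M) / B.truncInfo M) := by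
  rw [hT.lintegral_eq_tsum]
  refine ENNReal.tsum_le_of_sum_range_le fun n => ?_
  have hY : Measurable fun x => min (-B.logLR x) M := B.measurable_logLR.neg.min measurable_const
  have hint : ∀ k ∈ Finset.range n, Integrable (fun ω =>
      {ω | (k : ℕ∞) < T ω}.indicator (fun _ => (1 : ℝ)) ω * min (-B.logLR (ω k)) M) (B.P 0) := by
    intro k _
    refine (B.indepFun_indicator_eval 0 (hT.measurableSet_lt k) hY).integrable_mul ?_ ?_
    · exact (integrable_const _).indicator (obsSigma_le k _ (hT.measurableSet_lt k))
    · exact (B.measurePreserving_eval 0 k).integrable_comp_of_integrable (B.integrable_min M)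
  -- Wald's identity for the time capped at `n`; the bound does not depend on `n`, so integrability
  -- of `T` need not be known beforehand.
  have key : (∑ k ∈ Finset.range n, (B.P 0).real {ω | (k : ℕ∞) < T ω}) * B.truncInfo M ≤ b + M := by
    calc _ = ∑ k ∈ Finset.range n, ∫ ω, {ω | (k : ℕ∞) < T ω}.indicator (fun _ => (1 : ℝ)) ω *
          min (-B.logLR (ω k)) M ∂(B.P 0) := by
          rw [Finset.sum_mul]
          exact Finset.sum_congr rfl fun k _ =>
            (B.integral_indicator_mul_eval (hT.measurableSet_lt k) hY).symm
      _ = ∫ ω, ∑ k ∈ Finset.range n, {ω | (k : ℕ∞) < T ω}.indicator (fun _ => (1 : ℝ)) ω *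
          min (-B.logLR (ω k)) M ∂(B.P 0) := (integral_finsetSum _ hint).symm
      _ ≤ ∫ _, (b + M) ∂(B.P 0) :=
          integral_mono (integrable_finsetSum _ hint) (integrable_const _)
            fun ω => B.sum_indicator_min_le hb hM hTb n ω
      _ = b + M := by simp
  rw [← le_div_iff₀ hμ] at key
  refine le_trans (le_of_eq ?_) (ENNReal.ofReal_le_ofReal key)
  rw [ENNReal.ofReal_sum_of_nonneg fun k _ => measureReal_nonneg]
  exact Finset.sum_congr rfl fun k _ => (ofReal_measureReal).symm

/-! ### Law of large numbers and the lower bound on expected sample sizes -/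

lemma identDistrib_eval (i : Fin 2) {Y : 𝒳 → ℝ} (hY : Measurable Y) (j k : ℕ) :
    ProbabilityTheory.IdentDistrib (fun ω : ℕ → 𝒳 => Y (ω j)) (fun ω => Y (ω k)) (B.P i) (B.P i) where
  aemeasurable_fst := (hY.comp (measurable_pi_apply j)).aemeasurable
  aemeasurable_snd := (hY.comp (measurable_pi_apply k)).aemeasurable
  map_eq := by
    change Measure.map (Y ∘ fun ω : ℕ → 𝒳 => ω j) _ = Measure.map (Y ∘ fun ω : ℕ → 𝒳 => ω k) _
    rw [← Measure.map_map hY (measurable_pi_apply j), ← Measure.map_map hY (measurable_pi_apply k),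
      (B.measurePreserving_eval i j).map_eq, (B.measurePreserving_eval i k).map_eq]

lemma iIndepFun_comp_eval (i : Fin 2) {Y : 𝒳 → ℝ} (hY : Measurable Y) :
    ProbabilityTheory.iIndepFun (fun k (ω : ℕ → 𝒳) => Y (ω k)) (B.P i) :=
  (B.iIndepFun_eval i).comp (fun _ => Y) fun _ => hY

lemma tendsto_avgLLR :
    ∀ᵐ ω ∂(B.P 0), Tendsto (fun n : ℕ => B.avgLLR n ω) atTop (𝓝 (-B.info)) := by
  have h := ProbabilityTheory.strong_law_ae_real (μ := B.P 0)
    (fun k (ω : ℕ → 𝒳) => B.logLR (ω k))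
    ((B.measurePreserving_eval 0 0).integrable_comp_of_integrable B.integrable_logLR)
    (fun i j hij => (B.iIndepFun_comp_eval 0 B.measurable_logLR).indepFun hij)
    (fun i => B.identDistrib_eval 0 B.measurable_logLR i 0)
  have h2 : ∫ ω : ℕ → 𝒳, B.logLR (ω 0) ∂(B.P 0) = -B.info := by
    rw [info, integral_neg, neg_neg, ← (B.measurePreserving_eval 0 0).map_eq]
    exact (integral_map (measurable_pi_apply 0).aemeasurable
      B.measurable_logLR.aestronglyMeasurable).symm
  rw [h2] at h
  exact h

/-- By the strong law, `LLR k` exceeds `-(c * k)`, hence `-(c * n)`, for all `k ≤ n` past a random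
index; the finitely many earlier values are dominated by `c * n` for large `n`. -/
lemma tendsto_P_zero_exists_LLR_lt {c : ℝ} (hc : B.info < c) :
    Tendsto (fun n : ℕ => B.P 0 {ω | ∃ k ≤ n, B.LLR k ω < -(c * n)}) atTop (𝓝 0) := by
  have hc0 : 0 < c := B.info_pos.trans hc
  rw [← measure_empty (μ := B.P 0)]
  refine tendsto_measure_of_ae_tendsto_indicator_of_isFiniteMeasure atTop MeasurableSet.empty
    (fun n => ?_) ?_
  · have : {ω | ∃ k ≤ n, B.LLR k ω < -(c * n)} =
        ⋃ k ∈ Finset.range (n + 1), {ω | B.LLR k ω < -(c * n)} := by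
      ext ω; simp
    rw [this]
    exact Finset.measurableSet_biUnion _ fun k _ =>
      measurableSet_lt (B.measurable_LLR k) measurable_const
  · filter_upwards [B.tendsto_avgLLR] with ω hω
    obtain ⟨k₀, hk₀⟩ := eventually_atTop.1 (hω.eventually (lt_mem_nhds (neg_lt_neg hc)))
    obtain ⟨N, hN⟩ := exists_nat_ge ((∑ j ∈ Finset.range k₀, |B.LLR j ω|) / c)
    filter_upwards [eventually_ge_atTop N] with n hn
    simp only [Set.mem_empty_iff_false, iff_false, not_exists, not_and, not_lt]
    intro k hk
    rcases lt_or_ge k k₀ with h | h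
    · have h1 : |B.LLR k ω| ≤ ∑ j ∈ Finset.range k₀, |B.LLR j ω| :=
        Finset.single_le_sum (f := fun j => |B.LLR j ω|) (fun _ _ => abs_nonneg _)
          (Finset.mem_range.2 h)
      rw [div_le_iff₀ hc0] at hN
      have h2 : (N : ℝ) * c ≤ n * c := by gcongr
      linarith [neg_abs_le (B.LLR k ω)]
    · rcases Nat.eq_zero_or_pos k with rfl | hk0
      · simp only [LLR_eq, Finset.range_zero, Finset.sum_empty]
        have : 0 ≤ c * n := by positivity
        linarith
      · have h1 := hk₀ k h
        have hk0' : (0 : ℝ) < k := Nat.cast_pos.2 hk0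
        rw [avgLLR, lt_div_iff₀ hk0'] at h1
        have h2 : (k : ℝ) ≤ n := Nat.cast_le.2 hk
        nlinarith

lemma tendsto_abs_log : Tendsto (fun x : ℝ => |Real.log x|) (𝓝[>] 0) atTop :=
  tendsto_abs_atBot_atTop.comp Real.tendsto_log_nhdsGT_zero

/-- Bound on the probability that a test stops within `n` observations. -/
lemma P_zero_stop_le {T : (ℕ → 𝒳) → ℕ∞} {E : ℕ → Set (ℕ → 𝒳)} {R : Set (ℕ → 𝒳)}
    (hE : ∀ k, MeasurableSet[obsSigma 𝒳 k] (E k)) (hET : ∀ k, E k ⊆ {ω | T ω = k})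
    (hR : ∀ k : ℕ, {ω | T ω = k} ⊆ E k ∪ R) (n : ℕ) (a : ℝ) :
    B.P 0 {ω | T ω ≤ n} ≤ B.P 0 R + ENNReal.ofReal (Real.exp a) * B.P 1 (⋃ k, E k) +
      B.P 0 {ω | ∃ k ≤ n, B.LLR k ω < -a} := by
  -- A path stopped by time `n` lies in `R`, or has a log-likelihood ratio below `-a`, or accepts
  -- with a ratio of at least `-a`; the last event is controlled by its probability under `P 1`.
  have hF := B.P_zero_iUnion_le (E := fun k => E k ∩ {ω | -a ≤ B.LLR k ω})
    (fun k => (hE k).inter (measurableSet_le measurable_const (B.measurable_LLR_obsSigma le_rfl)))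
    (fun i j hij => Set.disjoint_left.2 fun ω hi hj => hij (by
      have h1 := hET i hi.1
      have h2 := hET j hj.1
      simp only [Set.mem_ofPred_eq] at h1 h2
      exact Nat.cast_injective (h1.symm.trans h2)))
    (a := -a) (fun k ω hω => hω.2)
  rw [neg_neg] at hF
  calc B.P 0 {ω | T ω ≤ n} ≤ B.P 0 ((R ∪ ⋃ k, (E k ∩ {ω | -a ≤ B.LLR k ω})) ∪
        {ω | ∃ k ≤ n, B.LLR k ω < -a}) := by
        refine measure_mono fun ω hω => ?_
        obtain ⟨k, hk⟩ := ENat.ne_top_iff_exists.1 (ne_top_of_le_ne_top (ENat.natCast_ne_top n) hω)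
        have hkn : k ≤ n := by
          have : (k : ℕ∞) ≤ n := hk.trans_le hω
          exact Nat.cast_le.1 this
        rcases hR k hk.symm with h | h
        · rcases lt_or_ge (B.LLR k ω) (-a) with h2 | h2
          · exact Or.inr ⟨k, hkn, h2⟩
          · exact Or.inl (Or.inr (Set.mem_iUnion.2 ⟨k, h, h2⟩))
        · exact Or.inl (Or.inl h)
    _ ≤ _ := (measure_union_le _ _).trans (by
        gcongr
        refine (measure_union_le _ _).trans ?_
        gcongr
        refine hF.trans ?_
        gcongr
        exact Set.inter_subset_left)

/-- Asymptotic lower bound on the expected sample size under `P 0`: here `E k` is the event that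
the test stops after `k` observations and accepts, `R` that it rejects. -/
lemma eventually_le_lintegral {ε : ℝ} (h0 : 0 < ε) (h1 : ε < 1) :
    ∀ᶠ q : ℝ × ℝ in 𝓝[>] (0 : ℝ) ×ˢ 𝓝[>] (0 : ℝ),
      ∀ (T : (ℕ → 𝒳) → ℕ∞) (E : ℕ → Set (ℕ → 𝒳)) (R : Set (ℕ → 𝒳)), IsStopping T →
        (∀ k, MeasurableSet[obsSigma 𝒳 k] (E k)) → (∀ k, E k ⊆ {ω | T ω = k}) →
        (∀ k : ℕ, {ω | T ω = k} ⊆ E k ∪ R) → B.P 0 R ≤ ENNReal.ofReal q.1 →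
        B.P 1 (⋃ k, E k) ≤ ENNReal.ofReal q.2 →
        ENNReal.ofReal ((1 - ε) * (|Real.log q.2| / B.info)) ≤ ∫⁻ ω, (T ω : ℝ≥0∞) ∂(B.P 0) := by
  have hI := B.info_pos
  -- With `n` about `(1 - ε / 2) * |log β| / I_0` and `c` slightly above `I_0`, still `c * n ≤ κ *
  -- |log β|` with `κ < 1`, so `exp (c * n) * β` tends to 0.
  set c := B.info / (1 - ε / 4) with hc
  set κ := (1 - ε / 2) / (1 - ε / 4) with hκ
  have hκ1 : κ < 1 := by rw [hκ, div_lt_one (by linarith)]; linarith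
  have hcI : B.info < c := by rw [hc, lt_div_iff₀ (by linarith)]; nlinarith
  have hfst : Tendsto (fun q : ℝ × ℝ => q.1) (𝓝[>] (0 : ℝ) ×ˢ 𝓝[>] (0 : ℝ)) (𝓝[>] 0) := tendsto_fst
  have hsnd : Tendsto (fun q : ℝ × ℝ => q.2) (𝓝[>] (0 : ℝ) ×ˢ 𝓝[>] (0 : ℝ)) (𝓝[>] 0) := tendsto_snd
  have hL := tendsto_abs_log.comp hsnd
  set n : ℝ × ℝ → ℕ := fun q => ⌊(1 - ε / 2) * (|Real.log q.2| / B.info)⌋₊ with hn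
  have hnt : Tendsto n (𝓝[>] (0 : ℝ) ×ˢ 𝓝[>] (0 : ℝ)) atTop :=
    tendsto_nat_floor_atTop.comp
      ((hL.atTop_div_const hI).const_mul_atTop (by linarith : 0 < 1 - ε / 2))
  have hlim : Tendsto (fun q : ℝ × ℝ => ENNReal.ofReal q.1 +
      ENNReal.ofReal (Real.exp ((κ - 1) * |Real.log q.2|)) +
      B.P 0 {ω | ∃ k ≤ n q, B.LLR k ω < -(c * n q)}) (𝓝[>] (0 : ℝ) ×ˢ 𝓝[>] (0 : ℝ))
      (𝓝 (0 + 0 + 0)) := by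
    refine (Tendsto.add ?_ ?_).add ((B.tendsto_P_zero_exists_LLR_lt hcI).comp hnt)
    · have := (ENNReal.continuous_ofReal.tendsto 0).comp (hfst.mono_right nhdsWithin_le_nhds)
      simpa [Function.comp_def] using this
    · have h2 : Tendsto (fun q : ℝ × ℝ => Real.exp ((κ - 1) * |Real.log q.2|))
          (𝓝[>] (0 : ℝ) ×ˢ 𝓝[>] (0 : ℝ)) (𝓝 0) :=
        Real.tendsto_exp_atBot.comp (hL.const_mul_atTop_of_neg (by linarith))
      have := (ENNReal.continuous_ofReal.tendsto 0).comp h2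
      simpa [Function.comp_def] using this
  have hev := hlim.eventually (gt_mem_nhds (show (0 + 0 + 0 : ℝ≥0∞) < ENNReal.ofReal (ε / 2) by simpa using h0))
  filter_upwards [hev, hsnd.eventually self_mem_nhdsWithin,
    hsnd.eventually (nhdsWithin_le_nhds (gt_mem_nhds one_pos))] with q hq hq2 hq2'
  intro T E R hT hE hET hR hPR hPE
  have hq2 : 0 < q.2 := hq2
  have hlog : |Real.log q.2| = -Real.log q.2 := abs_of_neg (Real.log_neg hq2 hq2')
  have hL0 : 0 ≤ |Real.log q.2| := abs_nonneg _
  have hnle : (n q : ℝ) ≤ (1 - ε / 2) * (|Real.log q.2| / B.info) :=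
    Nat.floor_le (mul_nonneg (by linarith) (by positivity))
  have hnlt : (1 - ε / 2) * (|Real.log q.2| / B.info) < n q + 1 := Nat.lt_floor_add_one _
  have hcn : c * n q ≤ κ * |Real.log q.2| := by
    have : c * n q ≤ c * ((1 - ε / 2) * (|Real.log q.2| / B.info)) := by
      gcongr
      exact hI.le.trans hcI.le
    refine this.trans (le_of_eq ?_)
    rw [hc, hκ]
    have : 1 - ε / 4 ≠ 0 := by linarith
    field_simp
  have hPT : B.P 0 {ω | T ω ≤ n q} ≤ ENNReal.ofReal (ε / 2) := by
    refine ((B.P_zero_stop_le hE hET hR (n q) (c * n q)).trans ?_).trans hq.le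
    gcongr
    calc ENNReal.ofReal (Real.exp (c * n q)) * B.P 1 (⋃ k, E k)
        ≤ ENNReal.ofReal (Real.exp (κ * |Real.log q.2|)) * ENNReal.ofReal q.2 := by gcongr
      _ = _ := by
        rw [← ENNReal.ofReal_mul (Real.exp_pos _).le, sub_mul, one_mul, Real.exp_sub, hlog,
          Real.exp_neg (Real.log q.2), Real.exp_log hq2, div_inv_eq_mul]
  have hTm := measurable_toENNReal hT.measurable
  have hgt : ENNReal.ofReal (1 - ε / 2) ≤ B.P 0 {ω | ((n q + 1 : ℕ) : ℝ≥0∞) ≤ (T ω : ℝ≥0∞)} := by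
    have hset : {ω | ((n q + 1 : ℕ) : ℝ≥0∞) ≤ (T ω : ℝ≥0∞)} = {ω | T ω ≤ n q}ᶜ := by
      ext ω
      simp only [Set.mem_ofPred_eq, Set.mem_compl_iff, not_le]
      rw [← ENat.toENNReal_coe, ENat.toENNReal_le]
      push_cast
      exact ENat.add_one_le_iff (ENat.natCast_ne_top _)
    have hms : MeasurableSet {ω | T ω ≤ n q} := 
      hT.measurable (MeasurableSet.of_discrete (s := Set.Iic (n q : ℕ∞)))
    rw [hset, prob_compl_eq_one_sub hms, ENNReal.ofReal_sub _ (by linarith), ENNReal.ofReal_one]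
    exact tsub_le_tsub_left hPT 1
  calc ENNReal.ofReal ((1 - ε) * (|Real.log q.2| / B.info))
      ≤ ENNReal.ofReal ((n q + 1 : ℕ) * (1 - ε / 2)) := by
        refine ENNReal.ofReal_le_ofReal ?_
        push_cast
        have h3 : 0 ≤ |Real.log q.2| / B.info := by positivity
        -- Uses `(1 - ε / 2) ^ 2 ≥ 1 - ε`: one factor comes from the choice of `n`, the other from
        -- the probability of exceeding it.
        nlinarith [mul_nonneg h3 (sq_nonneg ε)]
    _ = (n q + 1 : ℕ) * ENNReal.ofReal (1 - ε / 2) := by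
        rw [ENNReal.ofReal_mul (Nat.cast_nonneg _), ENNReal.ofReal_natCast]
    _ ≤ (n q + 1 : ℕ) * B.P 0 {ω | ((n q + 1 : ℕ) : ℝ≥0∞) ≤ (T ω : ℝ≥0∞)} := by gcongr
    _ ≤ _ := mul_meas_ge_le_lintegral hTm _

/-! ### Exponential bounds -/

/-- The tangent at 0 bounds the slope from below and convexity bounds it by its value at `θ = 1`.
The majorant, free of `θ`, permits differentiating the moment generating function at 0 from the
right. -/
lemma abs_slope_exp_le {θ y : ℝ} (h0 : 0 < θ) (h1 : θ ≤ 1) :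
    |(Real.exp (θ * y) - 1) / θ| ≤ |y| + Real.exp y + 1 := by
  have hlow : y ≤ (Real.exp (θ * y) - 1) / θ := by
    rw [le_div_iff₀ h0]
    linarith [Real.add_one_le_exp (θ * y)]
  have hup : (Real.exp (θ * y) - 1) / θ ≤ Real.exp y - 1 := by
    rw [div_le_iff₀ h0]
    have := convexOn_exp.2 (Set.mem_univ y) (Set.mem_univ 0) h0.le (sub_nonneg.2 h1) (by ring)
    simp only [smul_eq_mul, mul_zero, add_zero, Real.exp_zero, mul_one] at this
    linarith
  rw [abs_le]
  constructor <;> linarith [neg_abs_le y, abs_nonneg y, Real.exp_pos y]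

lemma integrable_exp_mul_logLR {θ : ℝ} (h0 : 0 < θ) (h1 : θ ≤ 1) :
    Integrable (fun x => Real.exp (θ * B.logLR x)) (B.law 0) := by
  refine Integrable.mono' (B.integrable_exp_logLR.add (integrable_const (1 : ℝ)))
    (B.measurable_logLR.const_mul θ).exp.aestronglyMeasurable (Eventually.of_forall fun x => ?_)
  have := convexOn_exp.2 (Set.mem_univ (B.logLR x)) (Set.mem_univ 0) h0.le (sub_nonneg.2 h1)
    (by ring)
  simp only [smul_eq_mul, mul_zero, add_zero, Real.exp_zero, mul_one] at this
  rw [Real.norm_eq_abs, abs_of_pos (Real.exp_pos _), Pi.add_apply]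
  nlinarith [Real.exp_pos (B.logLR x)]

/-- The right derivative of the moment generating function at 0 is `-info`; only exponents in `(0,
1]` occur, where it is finite because the likelihood ratio has mean 1. -/
lemma exists_mgf_le {δ : ℝ} (hδ : 0 < δ) : ∃ θ, 0 < θ ∧ θ ≤ 1 ∧
    ∫ x, Real.exp (θ * B.logLR x) ∂(B.law 0) ≤ Real.exp (θ * (-B.info + δ)) := by
  have hlim : Tendsto (fun θ : ℝ => ∫ x, (Real.exp (θ * B.logLR x) - 1) / θ ∂(B.law 0)) (𝓝[>] 0)
      (𝓝 (∫ x, B.logLR x ∂(B.law 0))) := by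
    refine tendsto_integral_filter_of_dominated_convergence
      (fun x => |B.logLR x| + Real.exp (B.logLR x) + 1)
      (Eventually.of_forall fun θ =>
        (((B.measurable_logLR.const_mul θ).exp.sub_const 1).div_const θ).aestronglyMeasurable) ?_
      ((B.integrable_logLR.abs.add B.integrable_exp_logLR).add (integrable_const 1))
      (Eventually.of_forall fun x => ?_)
    · filter_upwards [Ioc_mem_nhdsGT (zero_lt_one' ℝ)] with θ hθ
      exact Eventually.of_forall fun x => abs_slope_exp_le hθ.1 hθ.2
    · have hd : HasDerivAt (fun θ : ℝ => Real.exp (θ * B.logLR x)) (B.logLR x) 0 := by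
        have := ((hasDerivAt_id (0 : ℝ)).mul_const (B.logLR x)).exp
        simpa using this
      have := (hasDerivAt_iff_tendsto_slope_zero.1 hd).mono_left
        (nhdsWithin_mono (0 : ℝ) (fun y (hy : 0 < y) => ne_of_gt hy))
      refine this.congr fun θ => ?_
      simp [div_eq_inv_mul]
  have hI : ∫ x, B.logLR x ∂(B.law 0) = -B.info := by rw [info, integral_neg, neg_neg]
  rw [hI] at hlim
  obtain ⟨θ, hθ, h01⟩ := ((hlim.eventually (gt_mem_nhds (by linarith : -B.info < -B.info + δ))).and
    (Ioc_mem_nhdsGT (zero_lt_one' ℝ))).exists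
  refine ⟨θ, h01.1, h01.2, ?_⟩
  rw [integral_div, integral_sub (B.integrable_exp_mul_logLR h01.1 h01.2) (integrable_const 1),
    div_lt_iff₀ h01.1] at hθ
  simp only [integral_const, probReal_univ, smul_eq_mul, mul_one] at hθ
  linarith [Real.add_one_le_exp (θ * (-B.info + δ))]

lemma exists_P_zero_le_exp {δ : ℝ} (hδ : 0 < δ) : ∃ r, 0 < r ∧ ∀ n : ℕ,
    B.P 0 {ω | -B.info + δ ≤ B.avgLLR n ω} ≤ ENNReal.ofReal (Real.exp (-(n * r))) := by
  -- Half of `δ` goes into the moment generating function, the other half leaves the exponential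
  -- rate.
  obtain ⟨θ, h0, h1, hθ⟩ := B.exists_mgf_le (half_pos hδ)
  refine ⟨θ * (δ / 2), by positivity, fun n => ?_⟩
  rcases Nat.eq_zero_or_pos n with rfl | hn
  · simpa using prob_le_one
  have hn' : (0 : ℝ) < n := Nat.cast_pos.2 hn
  have hind := B.iIndepFun_comp_eval 0 B.measurable_logLR
  have hmeas : ∀ k, Measurable fun ω : ℕ → 𝒳 => B.logLR (ω k) := fun k =>
    B.measurable_logLR.comp (measurable_pi_apply k)
  have hL : B.LLR n = ∑ k ∈ Finset.range n, fun ω : ℕ → 𝒳 => B.logLR (ω k) := by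
    ext ω; simp [LLR_eq]
  have hset : {ω | -B.info + δ ≤ B.avgLLR n ω} = {ω | (n : ℝ) * (-B.info + δ) ≤ B.LLR n ω} := by
    ext ω
    simp only [Set.mem_ofPred_eq, avgLLR, le_div_iff₀ hn', mul_comm (n : ℝ)]
  have hmgf : ∀ k : ℕ, ProbabilityTheory.mgf (fun ω : ℕ → 𝒳 => B.logLR (ω k)) (B.P 0) θ =
      ∫ x, Real.exp (θ * B.logLR x) ∂(B.law 0) := by
    intro k
    rw [← (B.measurePreserving_eval 0 k).map_eq]
    exact (integral_map (φ := fun ω : ℕ → 𝒳 => ω k) (f := fun x => Real.exp (θ * B.logLR x))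
      (measurable_pi_apply k).aemeasurable
      (B.measurable_logLR.const_mul θ).exp.aestronglyMeasurable).symm
  have hintk : ∀ k ∈ Finset.range n, Integrable
      (fun ω : ℕ → 𝒳 => Real.exp (θ * B.logLR (ω k))) (B.P 0) := fun k _ =>
    (B.measurePreserving_eval 0 k).integrable_comp_of_integrable (B.integrable_exp_mul_logLR h0 h1)
  have hint : Integrable (fun ω => Real.exp (θ * B.LLR n ω)) (B.P 0) := by
    rw [hL]
    exact hind.integrable_exp_mul_sum hmeas hintk
  have hch := ProbabilityTheory.measure_ge_le_exp_mul_mgf (n * (-B.info + δ)) h0.le hint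
  rw [hset, ← ofReal_measureReal]
  refine ENNReal.ofReal_le_ofReal (hch.trans ?_)
  rw [hL, hind.mgf_sum hmeas, Finset.prod_congr rfl fun k _ => hmgf k, Finset.prod_const,
    Finset.card_range]
  calc Real.exp (-θ * (n * (-B.info + δ))) * (∫ x, Real.exp (θ * B.logLR x) ∂(B.law 0)) ^ n
      ≤ Real.exp (-θ * (n * (-B.info + δ))) * Real.exp (θ * (-B.info + δ / 2)) ^ n := by
        gcongr
    _ = _ := by
        rw [← Real.exp_nat_mul, ← Real.exp_add]
        congr 1
        ring

/-- Change of measure alone gives this rate, which is sharp to first order for `c` near `-info`. -/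
lemma P_one_avgLLR_le (n : ℕ) (c : ℝ) :
    B.P 1 {ω | B.avgLLR n ω ≤ c} ≤ ENNReal.ofReal (Real.exp (n * c)) := by
  rcases Nat.eq_zero_or_pos n with rfl | hn
  · simpa using prob_le_one
  have hn' : (0 : ℝ) < n := Nat.cast_pos.2 hn
  have h := B.swap.P_zero_le_of_le_LLR (n := n) (E := {ω | B.avgLLR n ω ≤ c}) (a := -(n * c))
    (measurableSet_le (B.measurable_avgLLR_obsSigma le_rfl) measurable_const)
    (fun ω hω => by
      rw [swap_LLR, neg_le_neg_iff, ← div_le_iff₀' hn']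
      exact hω)
  rw [neg_neg, swap_P_zero, swap_P_one] at h
  exact h.trans (mul_le_of_le_one_right' prob_le_one)

/-! ### The fixed-sample-size test -/

lemma exists_nat_ceil {a b I r : ℝ} (hI : 0 < I) (hr : 0 < r) (ha : a ∈ Set.Ioo (0 : ℝ) 1)
    (hb : b ∈ Set.Ioo (0 : ℝ) 1) : ∃ n : ℕ, 1 ≤ n ∧
      (n : ℝ) ≤ max (|Real.log b| / I) (|Real.log a| / r) + 1 ∧
      Real.exp (-(n * r)) ≤ a ∧ Real.exp (-(n * I)) ≤ b := by
  have hla := Real.log_neg ha.1 ha.2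
  have hlb := Real.log_neg hb.1 hb.2
  have hx : 0 < max (|Real.log b| / I) (|Real.log a| / r) :=
    lt_max_of_lt_left (div_pos (abs_pos.2 hlb.ne) hI)
  refine ⟨⌈max (|Real.log b| / I) (|Real.log a| / r)⌉₊, Nat.one_le_ceil_iff.2 hx,
    (Nat.ceil_lt_add_one hx.le).le, ?_, ?_⟩
  · rw [← Real.le_log_iff_exp_le ha.1, neg_le, ← div_le_iff₀ hr, ← abs_of_neg hla]
    exact (le_max_right _ _).trans (Nat.le_ceil _)
  · rw [← Real.le_log_iff_exp_le hb.1, neg_le, ← div_le_iff₀ hI, ← abs_of_neg hlb]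
    exact (le_max_left _ _).trans (Nat.le_ceil _)

lemma nStar_le {a b c : ℝ} {n : ℕ} (hn : 1 ≤ n) (h : B.FixedOK a b n c) : B.nStar a b ≤ n :=
  Nat.sInf_le (s := {n : ℕ | 1 ≤ n ∧ ∃ c : ℝ, B.FixedOK a b n c}) ⟨hn, c, h⟩

/-- Stein-type bound on the sample size of the fixed-sample-size test. -/
lemma exists_nStar_le_zero {δ : ℝ} (h0 : 0 < δ) (h1 : δ < B.info) : ∃ r, 0 < r ∧
    ∀ a ∈ Set.Ioo (0 : ℝ) 1, ∀ b ∈ Set.Ioo (0 : ℝ) 1,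
      (∃ n : ℕ, 1 ≤ n ∧ ∃ c, B.FixedOK a b n c) ∧
      (B.nStar a b : ℝ) ≤ max (|Real.log b| / (B.info - δ)) (|Real.log a| / r) + 1 := by
  obtain ⟨r, hr, hP⟩ := B.exists_P_zero_le_exp h0
  refine ⟨r, hr, fun a ha b hb => ?_⟩
  obtain ⟨n, hn1, hn, hna, hnb⟩ := exists_nat_ceil (sub_pos.2 h1) hr ha hb
  -- This threshold lies just above the limit of `avgLLR` under `P 0`: the type-II error decays at
  -- the nearly optimal rate `info - δ`, the type-I error still at some positive rate `r`.
  have hok : B.FixedOK a b n (-B.info + δ) := by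
    refine ⟨?_, ?_⟩
    · refine (measure_mono fun ω hω => ?_).trans ((hP n).trans (ENNReal.ofReal_le_ofReal hna))
      exact (show -B.info + δ < B.avgLLR n ω from hω).le
    · refine (B.P_one_avgLLR_le n _).trans (ENNReal.ofReal_le_ofReal (le_trans (le_of_eq ?_) hnb))
      congr 1; ring
  exact ⟨⟨n, hn1, _, hok⟩, (Nat.cast_le.2 (B.nStar_le hn1 hok)).trans hn⟩

/-- The mirror image is proved directly: exchanging the hypotheses exchanges strict and weak
inequalities at the threshold, so `nStar` of the two problems need not correspond. -/
lemma exists_nStar_le_one {δ : ℝ} (h0 : 0 < δ) (h1 : δ < B.swap.info) : ∃ r, 0 < r ∧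
    ∀ a ∈ Set.Ioo (0 : ℝ) 1, ∀ b ∈ Set.Ioo (0 : ℝ) 1,
      (B.nStar a b : ℝ) ≤ max (|Real.log a| / (B.swap.info - δ)) (|Real.log b| / r) + 1 := by
  obtain ⟨r, hr, hP⟩ := B.swap.exists_P_zero_le_exp h0
  refine ⟨r, hr, fun a ha b hb => ?_⟩
  obtain ⟨n, hn1, hn, hnb, hna⟩ := exists_nat_ceil (sub_pos.2 h1) hr hb ha
  have hok : B.FixedOK a b n (B.swap.info - δ) := by
    constructor
    · have h := B.swap.P_one_avgLLR_le n (-B.swap.info + δ)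
      refine (measure_mono fun ω hω => ?_).trans
        (h.trans (ENNReal.ofReal_le_ofReal (le_trans (le_of_eq ?_) hna)))
      · change B.swap.info - δ < B.avgLLR n ω at hω
        change B.swap.avgLLR n ω ≤ -B.swap.info + δ
        rw [swap_avgLLR]
        linarith
      · congr 1; ring
    · have h := hP n
      refine (measure_mono fun ω hω => ?_).trans (h.trans (ENNReal.ofReal_le_ofReal hnb))
      change B.avgLLR n ω ≤ B.swap.info - δ at hω
      change -B.swap.info + δ ≤ B.swap.avgLLR n ω
      rw [swap_avgLLR]
      linarith
  exact (Nat.cast_le.2 (B.nStar_le hn1 hok)).trans hn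

/-- The defining set is nonempty by the Stein-type bound, so `sInf` is a true minimum and not the
default 0. -/
lemma nStar_spec {a b : ℝ} (ha : a ∈ Set.Ioo (0 : ℝ) 1) (hb : b ∈ Set.Ioo (0 : ℝ) 1) :
    1 ≤ B.nStar a b ∧ ∃ c, B.FixedOK a b (B.nStar a b) c := by
  obtain ⟨r, -, h⟩ := B.exists_nStar_le_zero (half_pos B.info_pos) (half_lt_self B.info_pos)
  exact Nat.sInf_mem (s := {n : ℕ | 1 ≤ n ∧ ∃ c : ℝ, B.FixedOK a b n c}) (h a ha b hb).1

lemma measure_iUnion_lt_le {μ : Measure (ℕ → 𝒳)} {f : (ℕ → 𝒳) → ℝ} {A : ℝ≥0∞} {c : ℕ → ℝ}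
    (hc : Antitone c) (h : ∀ k, μ {ω | c k < f ω} ≤ A) : μ (⋃ k, {ω | c k < f ω}) ≤ A := by
  have hmono : Monotone fun k => {ω | c k < f ω} := fun i j hij ω hω =>
    lt_of_le_of_lt (hc hij) hω
  rw [hmono.measure_iUnion]
  exact iSup_le h

/-- Admissible thresholds tending to `-∞` would force the type-I bound `a` to be at least 1. -/
lemma bddBelow_fixedOK {a b : ℝ} (ha : a < 1) (n : ℕ) : BddBelow {c | B.FixedOK a b n c} := by
  by_contra hnb
  rw [not_bddBelow_iff] at hnb
  have h := measure_iUnion_lt_le (μ := B.P 0) (f := B.avgLLR n) (A := ENNReal.ofReal a)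
    (c := fun k : ℕ => -(k : ℝ)) (fun i j hij => neg_le_neg (Nat.cast_le.2 hij)) fun k => by
      obtain ⟨c, hc, hck⟩ := hnb (-k)
      exact (measure_mono fun ω hω => hck.trans hω).trans hc.1
  have huniv : (⋃ k : ℕ, {ω | -(k : ℝ) < B.avgLLR n ω}) = Set.univ := by
    refine Set.eq_univ_of_forall fun ω => Set.mem_iUnion.2 ?_
    obtain ⟨k, hk⟩ := exists_nat_gt (-B.avgLLR n ω)
    exact ⟨k, neg_lt.1 hk⟩
  rw [huniv, measure_univ, ENNReal.one_le_ofReal] at h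
  linarith

/-- The infimum is attained: the type-I error is right-continuous in the threshold, by continuity
from below of the measure, and the type-II error is monotone. -/
lemma fixedOK_cStar {a b : ℝ} (ha : a ∈ Set.Ioo (0 : ℝ) 1) (hb : b ∈ Set.Ioo (0 : ℝ) 1) :
    B.FixedOK a b (B.nStar a b) (B.cStar a b) := by
  have hbdd := B.bddBelow_fixedOK (b := b) ha.2 (B.nStar a b)
  have hne : {c | B.FixedOK a b (B.nStar a b) c}.Nonempty := (B.nStar_spec ha hb).2
  constructor
  · have h := measure_iUnion_lt_le (μ := B.P 0) (f := B.avgLLR (B.nStar a b))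
      (A := ENNReal.ofReal a) (c := fun k : ℕ => B.cStar a b + 1 / ((k : ℝ) + 1))
      (fun i j hij => by
        have := Nat.one_div_le_one_div (α := ℝ) hij
        simpa using this)
      fun k => by
        obtain ⟨c, hc, hck⟩ := exists_lt_of_csInf_lt hne
          (lt_add_of_pos_right (B.cStar a b) (Nat.one_div_pos_of_nat (α := ℝ) (n := k)))
        exact (measure_mono fun ω hω => hck.trans hω).trans hc.1
    refine (measure_mono fun ω hω => Set.mem_iUnion.2 ?_).trans h
    change B.cStar a b < B.avgLLR (B.nStar a b) ω at hω
    obtain ⟨k, hk⟩ := exists_nat_one_div_lt (sub_pos.2 hω)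
    exact ⟨k, by simpa using lt_sub_iff_add_lt'.1 hk⟩
  · obtain ⟨c, hc⟩ := hne
    exact (measure_mono fun ω hω => le_trans hω (csInf_le hbdd hc)).trans hc.2

end BinaryProblem

/-! ### Familywise error control -/

lemma one_sub_pow_le_iff {p α : ℝ} {N : ℕ} (hN : N ≠ 0) (hp : p ≤ 1) (hα : α < 1) :
    1 - (1 - p) ^ N ≤ α ↔ p ≤ 1 - (1 - α) ^ (1 / (N : ℝ)) := by
  have h : (1 - α) ^ (1 / (N : ℝ)) ≤ 1 - p ↔ 1 - α ≤ (1 - p) ^ N := by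
    rw [one_div, Real.rpow_inv_le_iff_of_pos (by linarith) (by linarith) (by positivity),
      Real.rpow_natCast]
  rw [sub_le_comm, ← h, le_sub_comm]

lemma one_sub_rpow_mem {α : ℝ} {N : ℕ} (hN : N ≠ 0) (hα : α ∈ Set.Ioo (0 : ℝ) 1) :
    1 - (1 - α) ^ (1 / (N : ℝ)) ∈ Set.Ioo (0 : ℝ) 1 := by
  have h1 : 0 < 1 - α := by linarith [hα.2]
  have h2 := Real.rpow_pos_of_pos h1 (1 / (N : ℝ))
  have h3 := Real.rpow_lt_one h1.le (by linarith [hα.1]) (show 0 < 1 / (N : ℝ) by positivity)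
  exact ⟨by linarith, by linarith⟩

lemma levelI_eq {m l : ℕ} (h : l ≤ m) (α : ℝ) :
    levelI m l α = 1 - (1 - α) ^ (1 / ((m - l : ℕ) : ℝ)) := by
  rw [levelI, Nat.cast_sub h]

lemma levelI_mem {m l : ℕ} (h : l < m) {α : ℝ} (hα : α ∈ Set.Ioo (0 : ℝ) 1) :
    levelI m l α ∈ Set.Ioo (0 : ℝ) 1 := by
  rw [levelI_eq h.le]
  exact one_sub_rpow_mem (by omega) hα

lemma levelII_mem {u : ℕ} (h : 0 < u) {β : ℝ} (hβ : β ∈ Set.Ioo (0 : ℝ) 1) :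
    levelII u β ∈ Set.Ioo (0 : ℝ) 1 :=
  one_sub_rpow_mem h.ne' hβ

lemma tendsto_one_sub_rpow {α : ℝ} (hα : α < 1) {N : ℕ → ℕ} (hN : Tendsto N atTop atTop) :
    Tendsto (fun m => 1 - (1 - α) ^ (1 / (N m : ℝ))) atTop (𝓝 0) := by
  have h1 : Tendsto (fun m => 1 / (N m : ℝ)) atTop (𝓝 0) :=
    tendsto_one_div_atTop_nhds_zero_nat.comp hN
  have h2 : Tendsto (fun m => (1 - α) ^ (1 / (N m : ℝ))) atTop (𝓝 ((1 - α) ^ (0 : ℝ))) :=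
    ((Real.continuous_const_rpow (by linarith)).tendsto 0).comp h1
  simpa using h2.const_sub 1

lemma pi_exists_mem {Ω : Type*} [MeasurableSpace Ω] {m : ℕ} (μ : Fin m → Measure Ω)
    [∀ j, IsProbabilityMeasure (μ j)] {G : Set Ω} (hG : MeasurableSet G) (S : Finset (Fin m))
    {p : ℝ} (hp0 : 0 ≤ p) (hp1 : p ≤ 1) (hμ : ∀ j ∈ S, μ j G = ENNReal.ofReal p) :
    Measure.pi μ {x | ∃ j, j ∈ S ∧ x j ∈ G} = ENNReal.ofReal (1 - (1 - p) ^ S.card) := by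
  classical
  -- The complement is a box, whose measure is a product.
  have hset : {x : Fin m → Ω | ∃ j, j ∈ S ∧ x j ∈ G} =
      (Set.univ.pi fun j => if j ∈ S then Gᶜ else Set.univ)ᶜ := by
    ext x
    simp only [Set.mem_ofPred_eq, Set.mem_compl_iff, Set.mem_univ_pi, not_forall]
    refine exists_congr fun j => ?_
    by_cases hj : j ∈ S <;> simp [hj]
  have hms : ∀ j, MeasurableSet (if j ∈ S then Gᶜ else Set.univ) := fun j => by
    split_ifs
    · exact hG.compl
    · exact MeasurableSet.univ
  have hprod : ∏ j, μ j (if j ∈ S then Gᶜ else Set.univ) = ENNReal.ofReal ((1 - p) ^ S.card) := by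
    have : ∀ j, μ j (if j ∈ S then Gᶜ else Set.univ) =
        if j ∈ S then ENNReal.ofReal (1 - p) else 1 := fun j => by
      split_ifs with hj
      · rw [prob_compl_eq_one_sub hG, hμ j hj, ENNReal.ofReal_sub _ hp0, ENNReal.ofReal_one]
      · exact measure_univ
    rw [Finset.prod_congr rfl fun j _ => this j, Finset.prod_ite_mem, Finset.univ_inter,
      Finset.prod_const, ENNReal.ofReal_pow (by linarith)]
  rw [hset, prob_compl_eq_one_sub (MeasurableSet.univ_pi hms), Measure.pi_pi, hprod,
    ENNReal.ofReal_sub _ (pow_nonneg (by linarith) _), ENNReal.ofReal_one]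

namespace BinaryProblem

variable {𝒳 : Type*} [MeasurableSpace 𝒳] (B : BinaryProblem 𝒳)

lemma measurableSet_decision {τ : TestRule 𝒳} (h : B.IsTest τ) (i : Fin 2) :
    MeasurableSet {ω | τ.D ω = i} :=
  h.measurable_D (measurableSet_singleton i)

lemma fweI_eq {m : ℕ} (A : Finset (Fin m)) {τ : TestRule 𝒳} (h : B.IsTest τ) :
    B.fweI A τ = ENNReal.ofReal (1 - (1 - (B.P 0).real {ω | τ.D ω = 1}) ^ (m - A.card)) := by
  have := pi_exists_mem (fun j : Fin m => B.P (if j ∈ A then 1 else 0))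
    (B.measurableSet_decision h 1) Aᶜ (p := (B.P 0).real {ω | τ.D ω = 1}) measureReal_nonneg
    measureReal_le_one fun j hj => by
      rw [if_neg (Finset.mem_compl.1 hj), ofReal_measureReal]
  rw [Finset.card_compl, Fintype.card_fin] at this
  rw [← this, fweI, streamLaw]
  simp only [Finset.mem_compl, Set.mem_ofPred_eq]

lemma fweII_eq {m : ℕ} (A : Finset (Fin m)) {τ : TestRule 𝒳} (h : B.IsTest τ) :
    B.fweII A τ = ENNReal.ofReal (1 - (1 - (B.P 1).real {ω | τ.D ω = 0}) ^ A.card) :=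
  pi_exists_mem (fun j : Fin m => B.P (if j ∈ A then 1 else 0))
    (B.measurableSet_decision h 0) A (p := (B.P 1).real {ω | τ.D ω = 0}) measureReal_nonneg
    measureReal_le_one fun j hj => by
      rw [if_pos hj, ofReal_measureReal]

theorem fweClass_eq_testClass {m l u : ℕ} (hlu : l ≤ u) (hum : u ≤ m) (hu : 0 < u) (hlm : l < m)
    {α β : ℝ} (hα : α ∈ Set.Ioo (0 : ℝ) 1) (hβ : β ∈ Set.Ioo (0 : ℝ) 1) :
    B.fweClass m l u α β = B.testClass (levelI m l α) (levelII u β) := by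
  have key : ∀ (i : Fin 2) (S : Set (ℕ → 𝒳)) {x : ℝ} {N : ℕ}, x ∈ Set.Ioo (0 : ℝ) 1 → N ≠ 0 →
      (ENNReal.ofReal (1 - (1 - (B.P i).real S) ^ N) ≤ ENNReal.ofReal x ↔
        B.P i S ≤ ENNReal.ofReal (1 - (1 - x) ^ (1 / (N : ℝ)))) := by
    intro i S x N hx hN
    rw [← ofReal_measureReal (μ := B.P i) (s := S),
      ENNReal.ofReal_le_ofReal_iff (one_sub_rpow_mem hN hx).1.le,
      ENNReal.ofReal_le_ofReal_iff hx.1.le, one_sub_pow_le_iff hN measureReal_le_one hx.2]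
  ext τ
  refine and_congr_right fun h => ?_
  have hI := key 0 {ω | τ.D ω = 1} hα (show m - l ≠ 0 by omega)
  have hII := key 1 {ω | τ.D ω = 0} hβ hu.ne'
  rw [levelI_eq hlm.le, levelII, ← hI, ← hII]
  constructor
  · intro hA
    -- The extreme cases: `l` signals leave the most nulls to reject wrongly, `u` signals are the
    -- most to miss. They may be different signal sets.
    obtain ⟨A, -, hAl⟩ := Finset.exists_subset_card_eq
      (show l ≤ (Finset.univ : Finset (Fin m)).card by simpa using hlm.le)
    obtain ⟨A', -, hAu⟩ := Finset.exists_subset_card_eq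
      (show u ≤ (Finset.univ : Finset (Fin m)).card by simpa using hum)
    have h1 := (hA A hAl.ge (hAl.le.trans hlu)).1
    have h2 := (hA A' (hlu.trans hAu.ge) hAu.le).2
    rw [B.fweI_eq A h, hAl] at h1
    rw [B.fweII_eq A' h, hAu] at h2
    exact ⟨h1, h2⟩
  · rintro ⟨h1, h2⟩ A hlA hAu
    rw [B.fweI_eq A h, B.fweII_eq A h]
    have hpow : ∀ (i : Fin 2) (S : Set (ℕ → 𝒳)) {j k : ℕ}, j ≤ k →
        1 - (1 - (B.P i).real S) ^ j ≤ 1 - (1 - (B.P i).real S) ^ k := fun i S j k hjk =>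
      sub_le_sub_left (pow_le_pow_of_le_one (sub_nonneg.2 measureReal_le_one)
        (by linarith [measureReal_nonneg (μ := B.P i) (s := S)]) hjk) 1
    exact ⟨(ENNReal.ofReal_le_ofReal (hpow 0 _ (by omega))).trans h1,
      (ENNReal.ofReal_le_ofReal (hpow 1 _ hAu)).trans h2⟩

/-! ### Expected sample sizes -/

lemma ess_eq (π : ℝ) (τ : TestRule 𝒳) :
    B.ess π τ = ENNReal.ofReal (1 - π) * ∫⁻ ω, (τ.T ω : ℝ≥0∞) ∂(B.P 0) +
      ENNReal.ofReal π * ∫⁻ ω, (τ.T ω : ℝ≥0∞) ∂(B.P 1) := by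
  rw [ess, mixture, lintegral_add_measure, lintegral_smul_measure, lintegral_smul_measure,
    smul_eq_mul, smul_eq_mul]

lemma IsTest.isStopping {B : BinaryProblem 𝒳} {τ : TestRule 𝒳} (h : B.IsTest τ) :
    IsStopping τ.T := h.stopping

theorem avgESS_eq_ess {m : ℕ} (hm : 1 ≤ m) {τ : TestRule 𝒳} (h : B.IsTest τ) (A : Finset (Fin m)) :
    B.avgESS A τ = B.ess ((A.card : ℝ) / m) τ := by
  have hTm := measurable_toENNReal h.isStopping.measurable
  have h1 : ∀ j : Fin m, ∫⁻ x, (τ.T (x j) : ℝ≥0∞) ∂(B.streamLaw m A) =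
      if j ∈ A then ∫⁻ ω, (τ.T ω : ℝ≥0∞) ∂(B.P 1) else ∫⁻ ω, (τ.T ω : ℝ≥0∞) ∂(B.P 0) := by
    intro j
    have := (MeasureTheory.measurePreserving_eval
      (fun j : Fin m => B.P (if j ∈ A then 1 else 0)) j).lintegral_comp hTm
    rw [streamLaw]
    refine this.trans ?_
    split_ifs <;> rfl
  have hm0 : (0 : ℝ) < m := Nat.cast_pos.2 hm
  have hAm : A.card ≤ m := by simpa using A.card_le_univ
  have h2 : ENNReal.ofReal (1 - (A.card : ℝ) / m) = (m : ℝ≥0∞)⁻¹ * ((m - A.card : ℕ) : ℝ≥0∞) := by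
    rw [one_sub_div hm0.ne', ← Nat.cast_sub hAm, ENNReal.ofReal_div_of_pos hm0,
      ENNReal.ofReal_natCast, ENNReal.ofReal_natCast, div_eq_mul_inv, mul_comm]
  have h3 : ENNReal.ofReal ((A.card : ℝ) / m) = (m : ℝ≥0∞)⁻¹ * (A.card : ℝ≥0∞) := by
    rw [ENNReal.ofReal_div_of_pos hm0,
      ENNReal.ofReal_natCast, ENNReal.ofReal_natCast, div_eq_mul_inv, mul_comm]
  rw [avgESS, ess_eq, h2, h3, Finset.sum_congr rfl fun j _ => h1 j, Finset.sum_ite,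
    Finset.sum_const, Finset.sum_const, nsmul_eq_mul, nsmul_eq_mul, mul_add, add_comm,
    mul_assoc, mul_assoc]
  have e1 : (Finset.univ.filter fun j => j ∈ A) = A := by ext; simp
  have e2 : (Finset.univ.filter fun j => j ∉ A) = Aᶜ := by ext; simp
  rw [e1, e2, Finset.card_compl, Fintype.card_fin]

/-! ### Asymptotic lower bounds for all tests and a criterion for optimality -/

lemma decision_eq_zero_or_one (i : Fin 2) : i = 0 ∨ i = 1 := by omega

/-- The bound under `P 1` is the one under `P 0` for the exchanged hypotheses, with the two
decisions and the two levels exchanged. -/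
lemma eventually_le_testClass {ε : ℝ} (h0 : 0 < ε) (h1 : ε < 1) :
    ∀ᶠ q : ℝ × ℝ in 𝓝[>] (0 : ℝ) ×ˢ 𝓝[>] (0 : ℝ), ∀ τ ∈ B.testClass q.1 q.2,
      ENNReal.ofReal ((1 - ε) * (|Real.log q.2| / B.info)) ≤ ∫⁻ ω, (τ.T ω : ℝ≥0∞) ∂(B.P 0) ∧
      ENNReal.ofReal ((1 - ε) * (|Real.log q.1| / B.swap.info)) ≤
        ∫⁻ ω, (τ.T ω : ℝ≥0∞) ∂(B.P 1) := by
  filter_upwards [B.eventually_le_lintegral h0 h1,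
    tendsto_prod_swap.eventually (B.swap.eventually_le_lintegral h0 h1)] with q hq hq' τ hτ
  have hcov : ∀ (i j : Fin 2), (∀ d : Fin 2, d = i ∨ d = j) → ∀ k : ℕ,
      {ω | τ.T ω = k} ⊆ {ω | τ.T ω = k ∧ τ.D ω = i} ∪ {ω | τ.D ω = j} := fun i j hij k ω hω =>
    (hij (τ.D ω)).imp (fun h => ⟨hω, h⟩) fun h => h
  have hsub : ∀ i : Fin 2, (⋃ k : ℕ, {ω | τ.T ω = k ∧ τ.D ω = i}) ⊆ {ω | τ.D ω = i} := fun i =>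
    Set.iUnion_subset fun k ω hω => hω.2
  constructor
  · exact hq τ.T (fun k => {ω | τ.T ω = k ∧ τ.D ω = 0}) {ω | τ.D ω = 1} hτ.1.isStopping
      (fun k => hτ.1.decision k 0) (fun k ω hω => hω.1)
      (hcov 0 1 decision_eq_zero_or_one) hτ.2.1 ((measure_mono (hsub 0)).trans hτ.2.2)
  · exact hq' τ.T (fun k => {ω | τ.T ω = k ∧ τ.D ω = 1}) {ω | τ.D ω = 0} hτ.1.isStopping
      (fun k => hτ.1.decision k 1) (fun k ω hω => hω.1)
      (hcov 1 0 fun d => (decision_eq_zero_or_one d).symm) hτ.2.2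
      ((measure_mono (hsub 1)).trans hτ.2.1)

lemma one_le_ess {τ : TestRule 𝒳} (h : B.IsTest τ) (π : ℝ) : 1 ≤ B.ess π τ := by
  have h1 : ∀ i, 1 ≤ ∫⁻ ω, (τ.T ω : ℝ≥0∞) ∂(B.P i) := fun i => by
    calc (1 : ℝ≥0∞) = ∫⁻ _, 1 ∂(B.P i) := by simp
      _ ≤ _ := lintegral_mono fun ω => by
          rw [← ENat.toENNReal_one, ENat.toENNReal_le]; exact h.one_le ω
  rw [ess_eq]
  calc (1 : ℝ≥0∞) = ENNReal.ofReal (1 - π + π) := by simp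
    _ ≤ ENNReal.ofReal (1 - π) * 1 + ENNReal.ofReal π * 1 := by
        rw [mul_one, mul_one]; exact ENNReal.ofReal_add_le
    _ ≤ _ := by gcongr <;> exact h1 _

/-- A comparison under both hypotheses passes to every mixture with the same constant; hence
uniformity in the number of signals. -/
lemma ess_le_mul_optESS {χ : TestRule 𝒳} {π α β c : ℝ} (hc : 0 < c)
    (h : ∀ τ ∈ B.testClass α β, ∀ i, ∫⁻ ω, (χ.T ω : ℝ≥0∞) ∂(B.P i) ≤
      ENNReal.ofReal c * ∫⁻ ω, (τ.T ω : ℝ≥0∞) ∂(B.P i)) :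
    B.ess π χ ≤ ENNReal.ofReal c * B.optESS π α β := by
  rw [mul_comm, ← ENNReal.div_le_iff_le_mul (Or.inl (by simpa using hc))
    (Or.inl ENNReal.ofReal_ne_top)]
  refine le_iInf₂ fun τ hτ => ?_
  rw [ENNReal.div_le_iff_le_mul (Or.inl (by simpa using hc)) (Or.inl ENNReal.ofReal_ne_top),
    mul_comm, ess_eq, ess_eq, mul_add, mul_left_comm, mul_left_comm (ENNReal.ofReal c)]
  gcongr <;> exact h τ hτ _

/-- A family of tests whose expected sample sizes attain the asymptotic lower bounds under both
hypotheses is asymptotically optimal in the high-dimensional sense. -/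
theorem highDimOptimal_of_eventually {l u : ℕ → ℕ}
    (hlu : ∀ m : ℕ, 1 ≤ m → l m ≤ u m ∧ u m ≤ m ∧ 0 < u m ∧ l m < m)
    (hu : Tendsto u atTop atTop) (hl : Tendsto (fun m : ℕ => m - l m) atTop atTop)
    {χ : ℝ → ℝ → TestRule 𝒳}
    (hχ : ∀ α ∈ Set.Ioo (0 : ℝ) 1, ∀ β ∈ Set.Ioo (0 : ℝ) 1, χ α β ∈ B.testClass α β)
    (h0 : ∀ η, 0 < η → ∀ᶠ q : ℝ × ℝ in 𝓝[>] (0 : ℝ) ×ˢ 𝓝[>] (0 : ℝ),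
      ∫⁻ ω, ((χ q.1 q.2).T ω : ℝ≥0∞) ∂(B.P 0) ≤
        ENNReal.ofReal ((1 + η) * (|Real.log q.2| / B.info)))
    (h1 : ∀ η, 0 < η → ∀ᶠ q : ℝ × ℝ in 𝓝[>] (0 : ℝ) ×ˢ 𝓝[>] (0 : ℝ),
      ∫⁻ ω, ((χ q.1 q.2).T ω : ℝ≥0∞) ∂(B.P 1) ≤
        ENNReal.ofReal ((1 + η) * (|Real.log q.1| / B.swap.info))) :
    B.HighDimOptimal l u χ := by
  refine ⟨hχ, fun α hα β hβ => ?_⟩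
  have hlimI : Tendsto (fun m => levelI m (l m) α) atTop (𝓝[>] 0) := by
    refine tendsto_nhdsWithin_iff.2 ⟨?_, ?_⟩
    · refine (tendsto_one_sub_rpow hα.2 hl).congr' ?_
      filter_upwards [eventually_ge_atTop 1] with m hm
      rw [levelI_eq (hlu m hm).2.2.2.le]
    · filter_upwards [eventually_ge_atTop 1] with m hm
      exact (levelI_mem (hlu m hm).2.2.2 hα).1
  have hlimII : Tendsto (fun m => levelII (u m) β) atTop (𝓝[>] 0) := by
    refine tendsto_nhdsWithin_iff.2 ⟨tendsto_one_sub_rpow hβ.2 hu, ?_⟩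
    filter_upwards [eventually_ge_atTop 1] with m hm
    exact (levelII_mem (hlu m hm).2.2.1 hβ).1
  have hlim := hlimI.prodMk hlimII
  have hlow : ∀ᶠ m in atTop, 1 ≤ (Finset.Icc (l m) (u m)).sup fun s : ℕ =>
      B.ess ((s : ℝ) / m) (χ (levelI m (l m) α) (levelII (u m) β)) /
        B.optESS ((s : ℝ) / m) (levelI m (l m) α) (levelII (u m) β) := by
    -- The family competes in the infimum, so each ratio is at least 1 once its numerator is finite;
    -- the upper bounds with `η = 1` serve only for finiteness.
    filter_upwards [eventually_ge_atTop 1, hlim.eventually (h0 1 one_pos),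
      hlim.eventually (h1 1 one_pos)] with m hm hm0 hm1
    have hmem := hχ _ (levelI_mem (hlu m hm).2.2.2 hα) _ (levelII_mem (hlu m hm).2.2.1 hβ)
    refine le_trans ?_ (Finset.le_sup (Finset.left_mem_Icc.2 (hlu m hm).1))
    rw [ENNReal.le_div_iff_mul_le, one_mul]
    · exact iInf₂_le _ hmem
    · exact Or.inr (one_pos.trans_le (B.one_le_ess hmem.1 _)).ne'
    · refine Or.inr ?_
      rw [ess_eq]
      exact ENNReal.add_ne_top.2 ⟨ENNReal.mul_ne_top ENNReal.ofReal_ne_top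
        (ne_top_of_le_ne_top ENNReal.ofReal_ne_top hm0),
        ENNReal.mul_ne_top ENNReal.ofReal_ne_top (ne_top_of_le_ne_top ENNReal.ofReal_ne_top hm1)⟩
  refine tendsto_order.2 ⟨fun a ha => hlow.mono fun m hm => ha.trans_le hm, fun b hb => ?_⟩
  obtain ⟨r, hr1, hrb⟩ := ENNReal.lt_iff_exists_nnreal_btwn.1 hb
  have hr1 : (1 : ℝ) < r := by exact_mod_cast hr1
  -- The solution of `(1 + ε) / (1 - ε) = r`.
  set ε : ℝ := (r - 1) / (r + 1) with hε
  have hε0 : 0 < ε := div_pos (by linarith) (by linarith)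
  have hε1 : ε < 1 := by rw [hε, div_lt_one (by linarith)]; linarith
  have hεr : 1 + ε = r * (1 - ε) := by
    rw [hε]; field_simp; ring
  filter_upwards [hlim.eventually (h0 ε hε0), hlim.eventually (h1 ε hε0),
    hlim.eventually (B.eventually_le_testClass hε0 hε1)] with m hm0 hm1 hm
  refine lt_of_le_of_lt (Finset.sup_le fun s _ => ?_) hrb
  rw [← ENNReal.ofReal_coe_nnreal]
  refine ENNReal.div_le_of_le_mul (B.ess_le_mul_optESS (by linarith) fun τ hτ => ?_)
  have hmul : ∀ x : ℝ, ENNReal.ofReal ((1 + ε) * x) =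
      ENNReal.ofReal r * ENNReal.ofReal ((1 - ε) * x) := fun x => by
    rw [← ENNReal.ofReal_mul (by linarith), ← mul_assoc, hεr]
  refine Fin.forall_fin_two.2 ⟨?_, ?_⟩
  · refine hm0.trans ?_
    rw [hmul]
    gcongr
    exact (hm τ hτ).1
  · refine hm1.trans ?_
    rw [hmul]
    gcongr
    exact (hm τ hτ).2

/-! ### The Sequential Probability Ratio Test -/

lemma lt_sprtTime_iff {a b : ℝ} {ω : ℕ → 𝒳} {n : ℕ} : (n : ℕ∞) < B.sprtTime a b ω ↔
    ∀ k ≤ n, 1 ≤ k → B.LLR k ω ∈ Set.Ioo (-b) a := by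
  constructor
  · intro h k hk hk1
    by_contra hmem
    have : B.sprtTime a b ω ≤ k := sInf_le ⟨k, rfl, hk1, hmem⟩
    exact absurd (h.trans_le this) (not_lt.2 (Nat.cast_le.2 hk))
  · intro h
    by_contra hle
    rw [not_lt] at hle
    have hne : {t : ℕ∞ | ∃ n : ℕ, t = n ∧ 1 ≤ n ∧ B.LLR n ω ∉ Set.Ioo (-b) a}.Nonempty := by
      by_contra hemp
      rw [Set.not_nonempty_iff_eq_empty] at hemp
      rw [sprtTime, hemp, sInf_empty] at hle
      exact ENat.natCast_ne_top n (top_le_iff.1 hle)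
    obtain ⟨k, hk, hk1, hmem⟩ := csInf_mem hne
    have hk' : B.sprtTime a b ω = k := hk
    rw [hk'] at hle
    exact hmem (h k (Nat.cast_le.1 hle) hk1)

lemma one_le_sprtTime (a b : ℝ) (ω : ℕ → 𝒳) : 1 ≤ B.sprtTime a b ω := by
  refine Order.one_le_iff_ne_zero.2 (pos_iff_ne_zero.1 ?_)
  have := (B.lt_sprtTime_iff (a := a) (b := b) (ω := ω) (n := 0)).2
    fun k hk hk1 => absurd hk1 (by omega)
  simpa using this

lemma isStopping_sprtTime (a b : ℝ) : IsStopping (B.sprtTime a b) := by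
  have hm : ∀ n : ℕ, MeasurableSet[obsSigma 𝒳 n] {ω | (n : ℕ∞) < B.sprtTime a b ω} := by
    intro n
    have : {ω | (n : ℕ∞) < B.sprtTime a b ω} =
        ⋂ k ∈ Finset.Icc 1 n, B.LLR k ⁻¹' Set.Ioo (-b) a := by
      ext ω
      simp only [Set.mem_ofPred_eq, lt_sprtTime_iff, Set.mem_iInter, Finset.mem_Icc, Set.mem_preimage]
      exact ⟨fun h k hk => h k hk.2 hk.1, fun h k hk hk1 => h k ⟨hk1, hk⟩⟩
    rw [this]
    exact Finset.measurableSet_biInter _ fun k hk =>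
      B.measurable_LLR_obsSigma (Finset.mem_Icc.1 hk).2 measurableSet_Ioo
  intro n
  cases n with
  | zero =>
    have : {ω | B.sprtTime a b ω = ((0 : ℕ) : ℕ∞)} = ∅ := by
      ext ω
      have := B.one_le_sprtTime a b ω
      simp only [Set.mem_ofPred_eq, Set.mem_empty_iff_false, iff_false]
      intro h
      rw [h] at this
      simp at this
    rw [this]
    exact @MeasurableSet.empty _ (obsSigma 𝒳 0)
  | succ n =>
    have : {ω | B.sprtTime a b ω = ((n + 1 : ℕ) : ℕ∞)} =
        {ω | (n : ℕ∞) < B.sprtTime a b ω} \ {ω | ((n + 1 : ℕ) : ℕ∞) < B.sprtTime a b ω} := by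
      ext ω
      simp only [Set.mem_ofPred_eq, Set.mem_sdiff, not_lt]
      rw [← ENat.add_one_le_iff (ENat.natCast_ne_top n)]
      push_cast
      exact ⟨fun h => ⟨h.ge, h.le⟩, fun h => le_antisymm h.2 h.1⟩
    rw [this]
    exact (obsSigma_mono n.le_succ _ (hm n)).diff (hm (n + 1))

lemma neg_LLR_le_of_lt_sprtTime {a b : ℝ} (hb : 0 ≤ b) (ω : ℕ → 𝒳) (n : ℕ)
    (h : (n : ℕ∞) < B.sprtTime a b ω) : -B.LLR n ω ≤ b := by
  rcases Nat.eq_zero_or_pos n with rfl | hn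
  · simpa [LLR_eq] using hb
  · linarith [(B.lt_sprtTime_iff.1 h n le_rfl hn).1]

lemma LLR_le_of_lt_sprtTime {a b : ℝ} (ha : 0 ≤ a) (ω : ℕ → 𝒳) (n : ℕ)
    (h : (n : ℕ∞) < B.sprtTime a b ω) : B.LLR n ω ≤ a := by
  rcases Nat.eq_zero_or_pos n with rfl | hn
  · simpa [LLR_eq] using ha
  · exact (B.lt_sprtTime_iff.1 h n le_rfl hn).2.le

lemma LLR_notMem_of_sprtTime_eq {a b : ℝ} {ω : ℕ → 𝒳} {n : ℕ} (h : B.sprtTime a b ω = n) :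
    B.LLR n ω ∉ Set.Ioo (-b) a := by
  intro hmem
  have hlt : (n : ℕ∞) < B.sprtTime a b ω := by
    rw [lt_sprtTime_iff]
    intro k hk hk1
    rcases hk.eq_or_lt with rfl | hlt
    · exact hmem
    · have : (k : ℕ∞) < B.sprtTime a b ω := by rw [h]; exact Nat.cast_lt.2 hlt
      exact B.lt_sprtTime_iff.1 this k le_rfl hk1
  exact hlt.ne' h

lemma lintegral_sprtTime_zero_le {a b M : ℝ} (hb : 0 ≤ b) (hM : 0 ≤ M)
    (hμ : 0 < B.truncInfo M) : ∫⁻ ω, (B.sprtTime a b ω : ℝ≥0∞) ∂(B.P 0) ≤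
      ENNReal.ofReal ((b + M) / B.truncInfo M) :=
  B.lintegral_stopping_le (B.isStopping_sprtTime a b) hb hM (B.neg_LLR_le_of_lt_sprtTime hb) hμ

lemma lintegral_sprtTime_one_le {a b M : ℝ} (ha : 0 ≤ a) (hM : 0 ≤ M)
    (hμ : 0 < B.swap.truncInfo M) : ∫⁻ ω, (B.sprtTime a b ω : ℝ≥0∞) ∂(B.P 1) ≤
      ENNReal.ofReal ((a + M) / B.swap.truncInfo M) :=
  B.swap.lintegral_stopping_le (B.isStopping_sprtTime a b) ha hM
    (fun ω n h => by rw [swap_LLR, neg_neg]; exact B.LLR_le_of_lt_sprtTime ha ω n h) hμ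

lemma ae_lt_top_of_lintegral_le {T : (ℕ → 𝒳) → ℕ∞} (hT : Measurable T) {i : Fin 2} {c : ℝ}
    (h : ∫⁻ ω, (T ω : ℝ≥0∞) ∂(B.P i) ≤ ENNReal.ofReal c) : ∀ᵐ ω ∂(B.P i), T ω < ⊤ := by
  filter_upwards [ae_lt_top (measurable_toENNReal hT)
    (ne_top_of_le_ne_top ENNReal.ofReal_ne_top h)] with ω hω
  simpa using hω

lemma ae_sprtTime_lt_top {a b : ℝ} (ha : 0 ≤ a) (hb : 0 ≤ b) (i : Fin 2) :
    ∀ᵐ ω ∂(B.P i), B.sprtTime a b ω < ⊤ := by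
  have hm := (B.isStopping_sprtTime a b).measurable
  rcases decision_eq_zero_or_one i with rfl | rfl
  · obtain ⟨M, hM, hμ⟩ := B.exists_truncInfo_gt B.info_pos
    exact B.ae_lt_top_of_lintegral_le hm (B.lintegral_sprtTime_zero_le hb hM hμ)
  · obtain ⟨M, hM, hμ⟩ := B.swap.exists_truncInfo_gt B.swap.info_pos
    exact B.ae_lt_top_of_lintegral_le hm (B.lintegral_sprtTime_one_le ha hM hμ)

lemma sprt_D_eq_one_iff {α β : ℝ} {ω : ℕ → 𝒳} : (B.sprt α β).D ω = 1 ↔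
    ∃ n : ℕ, B.sprtTime |Real.log α| |Real.log β| ω = n ∧ |Real.log α| ≤ B.LLR n ω := by
  simp [sprt]

lemma sprt_D_eq_zero_iff {α β : ℝ} {ω : ℕ → 𝒳} : (B.sprt α β).D ω = 0 ↔
    ¬ ∃ n : ℕ, B.sprtTime |Real.log α| |Real.log β| ω = n ∧ |Real.log α| ≤ B.LLR n ω := by
  simp [sprt]

lemma isTest_of_decision {τ : TestRule 𝒳} (h1 : ∀ ω, 1 ≤ τ.T ω) (hT : IsStopping τ.T)
    (hfin : ∀ i, ∀ᵐ ω ∂(B.P i), τ.T ω < ⊤) (hm : MeasurableSet {ω | τ.D ω = 1})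
    (hD : ∀ n : ℕ, MeasurableSet[obsSigma 𝒳 n] {ω | τ.T ω = n ∧ τ.D ω = 1}) : B.IsTest τ where
  one_le := h1
  stopping := hT
  finite := hfin
  decision := fun n => by
    refine Fin.forall_fin_two.2 ⟨?_, hD n⟩
    have : {ω | τ.T ω = n ∧ τ.D ω = 0} = {ω | τ.T ω = n} \ {ω | τ.T ω = n ∧ τ.D ω = 1} := by
      ext ω
      have : τ.D ω = 0 ↔ ¬ τ.D ω = 1 := by omega
      simp only [Set.mem_ofPred_eq, Set.mem_sdiff]
      tauto
    rw [this]
    exact (hT n).diff (hD n)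
  measurable_D := by
    refine measurable_to_countable' (Fin.forall_fin_two.2 ⟨?_, hm⟩)
    have : τ.D ⁻¹' {0} = {ω | τ.D ω = 1}ᶜ := by
      ext ω
      have : τ.D ω = 0 ↔ ¬ τ.D ω = 1 := by omega
      simpa using this
    rw [this]
    exact hm.compl

lemma sprt_mem_testClass {α β : ℝ} (hα : α ∈ Set.Ioo (0 : ℝ) 1) (hβ : β ∈ Set.Ioo (0 : ℝ) 1) :
    B.sprt α β ∈ B.testClass α β := by
  have hT := B.isStopping_sprtTime |Real.log α| |Real.log β|
  have hexpα : Real.exp (-|Real.log α|) = α := by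
    rw [abs_of_neg (Real.log_neg hα.1 hα.2), neg_neg, Real.exp_log hα.1]
  have hexpβ : Real.exp (-|Real.log β|) = β := by
    rw [abs_of_neg (Real.log_neg hβ.1 hβ.2), neg_neg, Real.exp_log hβ.1]
  have hE : ∀ (n : ℕ), MeasurableSet[obsSigma 𝒳 n]
      ({ω | B.sprtTime |Real.log α| |Real.log β| ω = n} ∩ {ω | |Real.log α| ≤ B.LLR n ω}) :=
    fun n => (hT n).inter (measurableSet_le measurable_const (B.measurable_LLR_obsSigma le_rfl))
  have hE' : ∀ (n : ℕ), MeasurableSet[obsSigma 𝒳 n]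
      ({ω | B.sprtTime |Real.log α| |Real.log β| ω = n} ∩ {ω | B.LLR n ω ≤ -|Real.log β|}) :=
    fun n => (hT n).inter (measurableSet_le (B.measurable_LLR_obsSigma le_rfl) measurable_const)
  have hdisj : ∀ S : ℕ → Set (ℕ → 𝒳), Pairwise (Function.onFun Disjoint fun n : ℕ =>
      {ω | B.sprtTime |Real.log α| |Real.log β| ω = n} ∩ S n) := by
    intro S i j hij
    refine Set.disjoint_left.2 fun ω hi hj => hij ?_
    have h1 : B.sprtTime |Real.log α| |Real.log β| ω = i := hi.1
    have h2 : B.sprtTime |Real.log α| |Real.log β| ω = j := hj.1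
    exact Nat.cast_injective (h1.symm.trans h2)
  have hD1 : {ω | (B.sprt α β).D ω = 1} = ⋃ n : ℕ,
      {ω | B.sprtTime |Real.log α| |Real.log β| ω = n} ∩ {ω | |Real.log α| ≤ B.LLR n ω} := by
    ext ω
    simp only [Set.mem_ofPred_eq, sprt_D_eq_one_iff, Set.mem_iUnion, Set.mem_inter_iff]
  refine ⟨B.isTest_of_decision (B.one_le_sprtTime _ _) hT
    (B.ae_sprtTime_lt_top (abs_nonneg _) (abs_nonneg _)) ?_ ?_, ?_, ?_⟩
  · rw [hD1]
    exact MeasurableSet.iUnion fun n => obsSigma_le n _ (hE n)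
  · intro n
    have : {ω | (B.sprt α β).T ω = n ∧ (B.sprt α β).D ω = 1} =
        {ω | B.sprtTime |Real.log α| |Real.log β| ω = n} ∩ {ω | |Real.log α| ≤ B.LLR n ω} := by
      ext ω
      simp only [Set.mem_ofPred_eq, sprt_D_eq_one_iff, Set.mem_inter_iff]
      refine and_congr_right fun h => ⟨?_, fun h2 => ⟨n, h, h2⟩⟩
      rintro ⟨k, hk, hk2⟩
      have : n = k := Nat.cast_injective (h.symm.trans hk)
      rwa [this]
    rw [this]
    exact hE n
  · rw [hD1]
    refine (B.P_zero_iUnion_le hE (hdisj _) fun n ω hω => hω.2).trans ?_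
    rw [hexpα]
    exact mul_le_of_le_one_right' prob_le_one
  -- Paths that never leave the interval also get decision 0, hence an inclusion up to a null set
  -- only.
  · have hae : {ω | (B.sprt α β).D ω = 0} ≤ᵐ[B.P 1] ⋃ n : ℕ,
        {ω | B.sprtTime |Real.log α| |Real.log β| ω = n} ∩ {ω | B.LLR n ω ≤ -|Real.log β|} := by
      filter_upwards [B.ae_sprtTime_lt_top (abs_nonneg (Real.log α)) (abs_nonneg (Real.log β)) 1]
        with ω hfin h0
      change (B.sprt α β).D ω = 0 at h0
      rw [sprt_D_eq_zero_iff] at h0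
      obtain ⟨n, hn⟩ := ENat.ne_top_iff_exists.1 hfin.ne
      refine Set.mem_iUnion.2 ⟨n, hn.symm, ?_⟩
      by_contra hlt
      have hlt : -|Real.log β| < B.LLR n ω := not_le.1 hlt
      exact B.LLR_notMem_of_sprtTime_eq hn.symm ⟨hlt, not_le.1 fun hle => h0 ⟨n, hn.symm, hle⟩⟩
    refine (measure_mono_ae hae).trans ?_
    refine (B.swap.P_zero_iUnion_le hE' (hdisj _) (a := |Real.log β|) fun n ω hω => ?_).trans ?_
    · rw [swap_LLR]
      exact le_neg.2 hω.2
    · rw [hexpβ]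
      exact mul_le_of_le_one_right' prob_le_one

/-- One half of `η` pays for the loss of drift from `I` to `μ`, the other for the constant `M`. -/
lemma eventually_add_div_le {I η : ℝ} (hI : 0 < I) (hη : 0 < η) {M μ : ℝ}
    (hμ : I / (1 + η / 2) < μ) : ∀ᶠ L : ℝ in atTop, (L + M) / μ ≤ (1 + η) * (L / I) := by
  filter_upwards [eventually_ge_atTop (|M| * (1 + η / 2) / (η / 2)), eventually_ge_atTop 0]
    with L hL hL0
  rw [div_le_iff₀ (by positivity)] at hL
  rw [div_lt_iff₀ (by positivity)] at hμ
  have hμ0 : 0 < μ := by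
    by_contra h
    nlinarith
  rw [div_le_iff₀ hμ0, ← mul_div_assoc, div_mul_eq_mul_div, le_div_iff₀ hI]
  have h1 : (L + M) * I ≤ (L + |M|) * (μ * (1 + η / 2)) := by
    gcongr
    exact le_abs_self M
  nlinarith

lemma eventually_sprt_zero {η : ℝ} (hη : 0 < η) : ∀ᶠ q : ℝ × ℝ in 𝓝[>] (0 : ℝ) ×ˢ 𝓝[>] (0 : ℝ),
    ∫⁻ ω, ((B.sprt q.1 q.2).T ω : ℝ≥0∞) ∂(B.P 0) ≤
      ENNReal.ofReal ((1 + η) * (|Real.log q.2| / B.info)) := by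
  have hI := B.info_pos
  have hc : 0 < B.info / (1 + η / 2) := by positivity
  obtain ⟨M, hM, hμ⟩ := B.exists_truncInfo_gt (c := B.info / (1 + η / 2))
    (div_lt_self hI (by linarith))
  have hsnd : Tendsto (fun q : ℝ × ℝ => q.2) (𝓝[>] (0 : ℝ) ×ˢ 𝓝[>] (0 : ℝ)) (𝓝[>] 0) := tendsto_snd
  filter_upwards [(tendsto_abs_log.comp hsnd).eventually (eventually_add_div_le (M := M) hI hη hμ)]
    with q hq
  exact (B.lintegral_sprtTime_zero_le (abs_nonneg _) hM (hc.trans hμ)).trans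
    (ENNReal.ofReal_le_ofReal hq)

lemma eventually_sprt_one {η : ℝ} (hη : 0 < η) : ∀ᶠ q : ℝ × ℝ in 𝓝[>] (0 : ℝ) ×ˢ 𝓝[>] (0 : ℝ),
    ∫⁻ ω, ((B.sprt q.1 q.2).T ω : ℝ≥0∞) ∂(B.P 1) ≤
      ENNReal.ofReal ((1 + η) * (|Real.log q.1| / B.swap.info)) := by
  have hI := B.swap.info_pos
  have hc : 0 < B.swap.info / (1 + η / 2) := by positivity
  obtain ⟨M, hM, hμ⟩ := B.swap.exists_truncInfo_gt (c := B.swap.info / (1 + η / 2))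
    (div_lt_self hI (by linarith))
  have hfst : Tendsto (fun q : ℝ × ℝ => q.1) (𝓝[>] (0 : ℝ) ×ˢ 𝓝[>] (0 : ℝ)) (𝓝[>] 0) := tendsto_fst
  filter_upwards [(tendsto_abs_log.comp hfst).eventually (eventually_add_div_le (M := M) hI hη hμ)]
    with q hq
  exact (B.lintegral_sprtTime_one_le (abs_nonneg _) hM (hc.trans hμ)).trans
    (ENNReal.ofReal_le_ofReal hq)

end BinaryProblem

/-! ### Error probabilities of the multistage design -/

lemma div_four_pow_mem {x : ℝ} (hx : x ∈ Set.Ioo (0 : ℝ) 1) {j : ℕ} (hj : j ≠ 0) :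
    (x / 4) ^ j ∈ Set.Ioo (0 : ℝ) 1 :=
  ⟨pow_pos (by linarith [hx.1]) _, pow_lt_one₀ (by linarith [hx.1]) (by linarith [hx.2]) hj⟩

lemma sum_Icc_pow_le {y : ℝ} (h0 : 0 ≤ y) (h1 : y < 1) (K : ℕ) :
    ∑ k ∈ Finset.Icc 1 K, y ^ k ≤ y / (1 - y) := by
  have h : ∀ K : ℕ, ∑ k ∈ Finset.Icc 1 K, y ^ k = (y - y ^ (K + 1)) / (1 - y) := by
    intro K
    have : 1 - y ≠ 0 := by linarith
    induction K with
    | zero => simp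
    | succ K ih =>
      rw [Finset.sum_Icc_succ_top (by omega), ih]
      field_simp
      ring
  rw [h]
  have := pow_nonneg h0 (K + 1)
  gcongr
  linarith

/-- The geometric sum takes at most `x / 3`, and 3/4 - 1/3 = 5/12. The first opportunity thus keeps
a fixed fraction of the level, whatever `K` is. -/
lemma activeErr_zero_ge {x : ℝ} (hx : x ∈ Set.Ioo (0 : ℝ) 1) (K : ℕ) :
    5 * x / 12 ≤ activeErr x K 0 := by
  have h := sum_Icc_pow_le (y := x / 4) (by linarith [hx.1]) (by linarith [hx.2]) K
  have h2 : x / 4 / (1 - x / 4) ≤ x / 3 := by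
    rw [div_le_iff₀ (by linarith [hx.2])]
    nlinarith [hx.1, hx.2]
  simp only [activeErr, if_true]
  linarith

lemma activeErr_mem {x : ℝ} (hx : x ∈ Set.Ioo (0 : ℝ) 1) (K j : ℕ) :
    activeErr x K j ∈ Set.Ioo (0 : ℝ) 1 := by
  rcases Nat.eq_zero_or_pos j with rfl | hj
  · refine ⟨lt_of_lt_of_le (by linarith [hx.1]) (activeErr_zero_ge hx K), ?_⟩
    have : 0 ≤ ∑ k ∈ Finset.Icc 1 K, (x / 4) ^ k :=
      Finset.sum_nonneg fun k _ => pow_nonneg (by linarith [hx.1]) _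
    simp only [activeErr, if_true]
    linarith [hx.2]
  · rw [activeErr, if_neg hj.ne']
    exact div_four_pow_mem hx hj.ne'

lemma inactiveErr_mem {γ x : ℝ} (hγ : γ ∈ Set.Ioo (0 : ℝ) 1) (hx : x ∈ Set.Ioo (0 : ℝ) 1) (j : ℕ) :
    inactiveErr γ x j ∈ Set.Ioo (0 : ℝ) 1 := by
  rw [inactiveErr]
  split_ifs with hj
  · exact hγ
  · exact div_four_pow_mem hx hj

lemma sum_activeErr (x : ℝ) (K : ℕ) :
    ∑ j ∈ Finset.range (K + 1), activeErr x K j = 3 * x / 4 := by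
  have h : ∑ j ∈ Finset.range K, activeErr x K (j + 1) = ∑ k ∈ Finset.Icc 1 K, (x / 4) ^ k := by
    rw [← Finset.Ico_add_one_right_eq_Icc, Finset.sum_Ico_eq_sum_range, Nat.add_sub_cancel]
    refine Finset.sum_congr rfl fun j _ => ?_
    rw [activeErr, if_neg j.succ_ne_zero, add_comm]
  rw [Finset.sum_range_succ', h]
  simp [activeErr]

namespace BinaryProblem

variable {𝒳 : Type*} [MeasurableSpace 𝒳] (B : BinaryProblem 𝒳)

lemma gmtRange_subset {α β : ℝ} (hα : 0 < α) (i : Fin 2) {γ : ℝ} (h : γ ∈ gmtRange α β i) :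
    γ ∈ Set.Ioo (0 : ℝ) 1 := by
  have h1 := le_max_left (3 * α) β
  have h2 := le_max_left α (3 * β)
  unfold gmtRange at h
  split_ifs at h
  · exact ⟨by linarith [h.1], h.2⟩
  · exact ⟨by linarith [h.1], h.2⟩

lemma gmtErr_mem {α β γ : ℝ} (hα : α ∈ Set.Ioo (0 : ℝ) 1) (hβ : β ∈ Set.Ioo (0 : ℝ) 1)
    (hγ : γ ∈ Set.Ioo (0 : ℝ) 1) (i : Fin 2) (j : ℕ) :
    (B.gmtErr α β i γ j).1 ∈ Set.Ioo (0 : ℝ) 1 ∧ (B.gmtErr α β i γ j).2 ∈ Set.Ioo (0 : ℝ) 1 := by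
  unfold gmtErr
  split_ifs
  · exact ⟨inactiveErr_mem hγ hβ j, activeErr_mem hβ _ j⟩
  · exact ⟨activeErr_mem hα _ j, inactiveErr_mem hγ hα j⟩

/-! ### Multistage tests are tests -/

lemma measurableSet_gmtAccepts (p : GMTParams) (n : ℕ) :
    MeasurableSet[obsSigma 𝒳 n] {ω | B.gmtAccepts p n ω} := by
  have : {ω | B.gmtAccepts p n ω} =
      ⋃ j ∈ {j | j ≤ p.K 0 ∧ p.N 0 j = n ∧ n < p.Nlast}, {ω | B.avgLLR n ω ≤ p.C 0 j} := by
    ext ω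
    simp only [gmtAccepts, Set.mem_ofPred_eq, Set.mem_iUnion, exists_prop, and_assoc]
  rw [this]
  exact MeasurableSet.biUnion (Set.to_countable _) fun j _ =>
    measurableSet_le (B.measurable_avgLLR_obsSigma le_rfl) measurable_const

lemma measurableSet_gmtRejects (p : GMTParams) (n : ℕ) :
    MeasurableSet[obsSigma 𝒳 n] {ω | B.gmtRejects p n ω} := by
  have : {ω | B.gmtRejects p n ω} =
      ⋃ j ∈ {j | j ≤ p.K 1 ∧ p.N 1 j = n ∧ n < p.Nlast}, {ω | p.C 1 j < B.avgLLR n ω} := by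
    ext ω
    simp only [gmtRejects, Set.mem_ofPred_eq, Set.mem_iUnion, exists_prop, and_assoc]
  rw [this]
  exact MeasurableSet.biUnion (Set.to_countable _) fun j _ =>
    measurableSet_lt measurable_const (B.measurable_avgLLR_obsSigma le_rfl)

lemma gmtTime_spec (p : GMTParams) (ω : ℕ → 𝒳) : B.gmtAccepts p (B.gmtTime p ω) ω ∨
    B.gmtRejects p (B.gmtTime p ω) ω ∨ B.gmtTime p ω = p.Nlast :=
  Nat.sInf_mem (s := {n : ℕ | B.gmtAccepts p n ω ∨ B.gmtRejects p n ω ∨ n = p.Nlast})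
    ⟨p.Nlast, Or.inr (Or.inr rfl)⟩

lemma gmtTime_le {p : GMTParams} {ω : ℕ → 𝒳} {n : ℕ}
    (h : B.gmtAccepts p n ω ∨ B.gmtRejects p n ω ∨ n = p.Nlast) : B.gmtTime p ω ≤ n :=
  Nat.sInf_le (s := {n : ℕ | B.gmtAccepts p n ω ∨ B.gmtRejects p n ω ∨ n = p.Nlast}) h

lemma gmtTime_le_last (p : GMTParams) (ω : ℕ → 𝒳) : B.gmtTime p ω ≤ p.Nlast :=
  B.gmtTime_le (Or.inr (Or.inr rfl))

/-- Also valid for an ignored opportunity, because the test has stopped by `Nlast` anyway. -/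
lemma gmtTime_le_of_accept {p : GMTParams} {ω : ℕ → 𝒳} {j : ℕ} (hj : j ≤ p.K 0)
    (h : B.avgLLR (p.N 0 j) ω ≤ p.C 0 j) : B.gmtTime p ω ≤ p.N 0 j := by
  rcases lt_or_ge (p.N 0 j) p.Nlast with hlt | hge
  · exact B.gmtTime_le (Or.inl ⟨j, hj, rfl, hlt, h⟩)
  · exact (B.gmtTime_le_last p ω).trans hge

lemma gmtTime_le_of_reject {p : GMTParams} {ω : ℕ → 𝒳} {j : ℕ} (hj : j ≤ p.K 1)
    (h : p.C 1 j < B.avgLLR (p.N 1 j) ω) : B.gmtTime p ω ≤ p.N 1 j := by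
  rcases lt_or_ge (p.N 1 j) p.Nlast with hlt | hge
  · exact B.gmtTime_le (Or.inr (Or.inl ⟨j, hj, rfl, hlt, h⟩))
  · exact (B.gmtTime_le_last p ω).trans hge

lemma isStopping_gmtTime (p : GMTParams) :
    IsStopping fun ω : ℕ → 𝒳 => (B.gmtTime p ω : ℕ∞) := by
  set S : ℕ → Set (ℕ → 𝒳) := fun n =>
    {ω | B.gmtAccepts p n ω} ∪ ({ω | B.gmtRejects p n ω} ∪ {_ω | n = p.Nlast}) with hS
  have hSm : ∀ n, MeasurableSet[obsSigma 𝒳 n] (S n) := fun n =>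
    (B.measurableSet_gmtAccepts p n).union
      ((B.measurableSet_gmtRejects p n).union (MeasurableSet.const _))
  intro n
  have : {ω : ℕ → 𝒳 | (B.gmtTime p ω : ℕ∞) = n} = S n ∩ ⋂ k ∈ Finset.range n, (S k)ᶜ := by
    ext ω
    simp only [Set.mem_ofPred_eq, Nat.cast_inj, Set.mem_inter_iff, Set.mem_iInter,
      Finset.mem_range, Set.mem_compl_iff]
    constructor
    · rintro rfl
      exact ⟨B.gmtTime_spec p ω, fun k hk hSk => absurd (B.gmtTime_le hSk) (not_le.2 hk)⟩
    · rintro ⟨h1, h2⟩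
      refine le_antisymm (B.gmtTime_le h1) (not_lt.1 fun hlt => h2 _ hlt (B.gmtTime_spec p ω))
  rw [this]
  exact (hSm n).inter (Finset.measurableSet_biInter _ fun k hk =>
    (obsSigma_mono (Finset.mem_range.1 hk).le _ (hSm k)).compl)

lemma gmtOf_D_eq_one_iff {p : GMTParams} {ω : ℕ → 𝒳} : (B.gmtOf p).D ω = 1 ↔
    B.gmtRejects p (B.gmtTime p ω) ω ∨
      (B.gmtTime p ω = p.Nlast ∧ p.Clast < B.avgLLR p.Nlast ω) := by
  simp only [gmtOf, ite_eq_left_iff, zero_ne_one, imp_false, not_not]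

lemma isTest_gmtOf {p : GMTParams} (hN : ∀ i, ∀ j ≤ p.K i, 1 ≤ p.N i j) (hlast : 1 ≤ p.Nlast) :
    B.IsTest (B.gmtOf p) := by
  have hT := B.isStopping_gmtTime p
  have hD : ∀ n : ℕ, MeasurableSet[obsSigma 𝒳 n]
      {ω | (B.gmtOf p).T ω = n ∧ (B.gmtOf p).D ω = 1} := by
    intro n
    have : {ω | (B.gmtOf p).T ω = n ∧ (B.gmtOf p).D ω = 1} =
        {ω | (B.gmtTime p ω : ℕ∞) = n} ∩ ({ω | B.gmtRejects p n ω} ∪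
          ({_ω | n = p.Nlast} ∩ {ω | p.Clast < B.avgLLR n ω})) := by
      ext ω
      simp only [Set.mem_ofPred_eq, gmtOf_D_eq_one_iff, Set.mem_inter_iff, Set.mem_union]
      refine and_congr_right fun h => ?_
      have h : B.gmtTime p ω = n := Nat.cast_injective (R := ℕ∞) h
      rw [h]
      refine or_congr_right (and_congr_right fun h2 => ?_)
      rw [h2]
    rw [this]
    exact (hT n).inter ((B.measurableSet_gmtRejects p n).union
      ((MeasurableSet.const _).inter
        (measurableSet_lt measurable_const (B.measurable_avgLLR_obsSigma le_rfl))))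
  refine B.isTest_of_decision (fun ω => ?_) hT
    (fun i => Eventually.of_forall fun ω => ENat.natCast_lt_top _) ?_ hD
  · change (1 : ℕ∞) ≤ (B.gmtTime p ω : ℕ∞)
    have : 1 ≤ B.gmtTime p ω := by
      rcases B.gmtTime_spec p ω with ⟨j, hj, h, -⟩ | ⟨j, hj, h, -⟩ | h
      · exact (hN 0 j hj).trans h.le
      · exact (hN 1 j hj).trans h.le
      · exact hlast.trans h.ge
    exact_mod_cast this
  · have : {ω | (B.gmtOf p).D ω = 1} =
        ⋃ n : ℕ, {ω | (B.gmtOf p).T ω = n ∧ (B.gmtOf p).D ω = 1} := by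
      ext ω
      simp only [Set.mem_ofPred_eq, Set.mem_iUnion]
      exact ⟨fun h => ⟨B.gmtTime p ω, rfl, h⟩, fun ⟨_, _, h⟩ => h⟩
    rw [this]
    exact MeasurableSet.iUnion fun n => obsSigma_le n _ (hD n)

lemma P_zero_gmtOf_le (p : GMTParams) : B.P 0 {ω | (B.gmtOf p).D ω = 1} ≤
    B.P 0 {ω | p.Clast < B.avgLLR p.Nlast ω} +
      ∑ j ∈ Finset.range (p.K 1 + 1), B.P 0 {ω | p.C 1 j < B.avgLLR (p.N 1 j) ω} := by
  refine (measure_mono ?_).trans ((measure_union_le _ _).trans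
    (add_le_add_right (measure_biUnion_finset_le _ _) _))
  intro ω hω
  change (B.gmtOf p).D ω = 1 at hω
  rcases B.gmtOf_D_eq_one_iff.1 hω with ⟨j, hj, hN, -, h⟩ | ⟨-, h⟩
  · refine Or.inr (Set.mem_iUnion₂.2 ⟨j, Finset.mem_range.2 (Nat.lt_succ_of_le hj), ?_⟩)
    rw [← hN] at h
    exact h
  · exact Or.inl h

lemma P_one_gmtOf_le (p : GMTParams) : B.P 1 {ω | (B.gmtOf p).D ω = 0} ≤
    B.P 1 {ω | B.avgLLR p.Nlast ω ≤ p.Clast} +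
      ∑ j ∈ Finset.range (p.K 0 + 1), B.P 1 {ω | B.avgLLR (p.N 0 j) ω ≤ p.C 0 j} := by
  refine (measure_mono ?_).trans ((measure_union_le _ _).trans
    (add_le_add_right (measure_biUnion_finset_le _ _) _))
  intro ω hω
  change (B.gmtOf p).D ω = 0 at hω
  have hω : ¬ (B.gmtOf p).D ω = 1 := by rw [hω]; exact zero_ne_one
  rw [gmtOf_D_eq_one_iff, not_or, not_and, not_lt] at hω
  rcases B.gmtTime_spec p ω with ⟨j, hj, hN, -, h⟩ | h | h
  · refine Or.inr (Set.mem_iUnion₂.2 ⟨j, Finset.mem_range.2 (Nat.lt_succ_of_le hj), ?_⟩)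
    rw [← hN] at h
    exact h
  · exact absurd h hω.1
  · exact Or.inl (hω.2 h)

lemma gmtOf_mem_testClass {α β : ℝ} (hα : α ∈ Set.Ioo (0 : ℝ) 1) (hβ : β ∈ Set.Ioo (0 : ℝ) 1)
    {γ : Fin 2 → ℝ} (hγ : ∀ i, γ i ∈ Set.Ioo (0 : ℝ) 1) :
    B.gmtOf (B.gmtParams α β γ) ∈ B.testClass α β := by
  have hα4 : α / 4 ∈ Set.Ioo (0 : ℝ) 1 := ⟨by linarith [hα.1], by linarith [hα.2]⟩
  have hβ4 : β / 4 ∈ Set.Ioo (0 : ℝ) 1 := ⟨by linarith [hβ.1], by linarith [hβ.2]⟩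
  have hlast := B.fixedOK_cStar hα4 hβ4
  have hok : ∀ i j, B.FixedOK (B.gmtErr α β i (γ i) j).1 (B.gmtErr α β i (γ i) j).2
      ((B.gmtParams α β γ).N i j) ((B.gmtParams α β γ).C i j) := fun i j =>
    B.fixedOK_cStar (B.gmtErr_mem hα hβ (hγ i) i j).1 (B.gmtErr_mem hα hβ (hγ i) i j).2
  -- The union bound spends `x / 4` on the last stage and `3 * x / 4` on all opportunities together.
  have hsum : ∀ {x : ℝ}, x ∈ Set.Ioo (0 : ℝ) 1 → ∀ K : ℕ, ENNReal.ofReal (x / 4) +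
      ∑ j ∈ Finset.range (K + 1), ENNReal.ofReal (activeErr x K j) = ENNReal.ofReal x := by
    intro x hx K
    rw [← ENNReal.ofReal_sum_of_nonneg fun j _ => (activeErr_mem hx K j).1.le, sum_activeErr,
      ← ENNReal.ofReal_add (by linarith [hx.1]) (by linarith [hx.1])]
    congr 1; ring
  refine ⟨B.isTest_gmtOf (fun i j _ => ?_) ?_, ?_, ?_⟩
  · exact (B.nStar_spec (B.gmtErr_mem hα hβ (hγ i) i j).1 (B.gmtErr_mem hα hβ (hγ i) i j).2).1
  · exact (B.nStar_spec hα4 hβ4).1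
  · refine (B.P_zero_gmtOf_le _).trans (le_trans ?_ (hsum hα (B.gmtK α β 1)).le)
    exact add_le_add hlast.1 (Finset.sum_le_sum fun j _ => (hok 1 j).1)
  · refine (B.P_one_gmtOf_le _).trans (le_trans ?_ (hsum hβ (B.gmtK α β 0)).le)
    exact add_le_add hlast.2 (Finset.sum_le_sum fun j _ => (hok 0 j).2)

/-! ### The bound on the expected sample size -/

/-- Let `j` be the first index with `A j`. Then `A (j - 1)` fails, so the summand `N j` is present;
without such an index the last term is `Nl`. The sample sizes need not be ordered. -/
lemma natCast_le_sum_stages {T Nl K : ℕ} {N : ℕ → ℕ} {A : ℕ → Prop} [DecidablePred A]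
    (hA : ∀ j ≤ K, A j → T ≤ N j) (hT : T ≤ Nl) :
    T ≤ N 0 + ∑ j ∈ Finset.Icc 1 K, (if A (j - 1) then 0 else N j) + if A K then 0 else Nl := by
  by_cases h : ∃ j, j ≤ K ∧ A j
  · classical
    obtain ⟨hjK, hAj⟩ := Nat.find_spec h
    have hmin := fun k (hk : k < Nat.find h) => Nat.find_min h hk
    set j := Nat.find h
    have hTj := hA j hjK hAj
    rcases Nat.eq_zero_or_pos j with h0 | hpos
    · rw [h0] at hTj
      omega
    · have h1 : ¬ A (j - 1) := fun h' => hmin (j - 1) (by omega) ⟨by omega, h'⟩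
      have h2 : (if A (j - 1) then 0 else N j) ≤
          ∑ j ∈ Finset.Icc 1 K, (if A (j - 1) then 0 else N j) :=
        Finset.single_le_sum (f := fun j => if A (j - 1) then 0 else N j)
          (fun _ _ => Nat.zero_le _) (Finset.mem_Icc.2 ⟨hpos, hjK⟩)
      rw [if_neg h1] at h2
      omega
  · have : ¬ A K := fun h' => h ⟨K, le_rfl, h'⟩
    rw [if_neg this]
    omega

lemma lintegral_stages_le (μ : Measure (ℕ → 𝒳)) [IsProbabilityMeasure μ]
    {T : (ℕ → 𝒳) → ℕ} {Nl K : ℕ} {N : ℕ → ℕ} {A : ℕ → Set (ℕ → 𝒳)} {g : ℕ → ℝ}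
    (hm : ∀ j, MeasurableSet (A j)) (hA : ∀ j ≤ K, ∀ ω ∈ A j, T ω ≤ N j) (hT : ∀ ω, T ω ≤ Nl)
    (hg : ∀ j, 0 ≤ g j) (hμ : ∀ j, μ (A j)ᶜ ≤ ENNReal.ofReal (g j)) :
    ∫⁻ ω, ((T ω : ℕ∞) : ℝ≥0∞) ∂μ ≤
      ENNReal.ofReal (N 0 + ∑ j ∈ Finset.Icc 1 K, (N j : ℝ) * g (j - 1) + Nl * g K) := by
  classical
  have hpt : ∀ ω, ((T ω : ℕ∞) : ℝ≥0∞) ≤ N 0 + ∑ j ∈ Finset.Icc 1 K,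
      (A (j - 1))ᶜ.indicator (fun _ => (N j : ℝ≥0∞)) ω + (A K)ᶜ.indicator (fun _ => (Nl : ℝ≥0∞)) ω := by
    intro ω
    have h := natCast_le_sum_stages (A := fun j => ω ∈ A j) (fun j hj h => hA j hj ω h) (hT ω)
    have h' : (T ω : ℝ≥0∞) ≤ _ := Nat.cast_le.2 h
    rw [ENat.toENNReal_coe]
    refine h'.trans (le_of_eq ?_)
    push_cast
    simp only [Set.indicator_apply, Set.mem_compl_iff, ite_not]
  have hind : ∀ j (c : ℝ≥0∞), Measurable ((A j)ᶜ.indicator fun _ => c) := fun j c =>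
    measurable_const.indicator (hm j).compl
  have hNg : ∀ j k, 0 ≤ (N j : ℝ) * g k := fun j k => mul_nonneg (Nat.cast_nonneg _) (hg k)
  refine (lintegral_mono hpt).trans ?_
  rw [lintegral_add_right _ (hind K _), lintegral_add_left measurable_const,
    lintegral_finsetSum _ fun j _ => hind (j - 1) _, lintegral_const, measure_univ, mul_one,
    lintegral_indicator_const (hm K).compl, 
    ENNReal.ofReal_add (add_nonneg (Nat.cast_nonneg _) (Finset.sum_nonneg fun j _ => hNg j _))
      (mul_nonneg (Nat.cast_nonneg _) (hg K)),
    ENNReal.ofReal_add (Nat.cast_nonneg _) (Finset.sum_nonneg fun j _ => hNg j _),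
    ENNReal.ofReal_natCast, ENNReal.ofReal_sum_of_nonneg fun j _ => hNg j _,
    ENNReal.ofReal_mul (Nat.cast_nonneg _), ENNReal.ofReal_natCast]
  gcongr with j
  · rw [lintegral_indicator_const (hm (j - 1)).compl, ENNReal.ofReal_mul (Nat.cast_nonneg _),
      ENNReal.ofReal_natCast]
    gcongr
    exact hμ _
  · exact hμ _

lemma lintegral_gmt_zero_le {α β : ℝ} (hα : α ∈ Set.Ioo (0 : ℝ) 1) (hβ : β ∈ Set.Ioo (0 : ℝ) 1)
    {γ : Fin 2 → ℝ} (hγ : ∀ i, γ i ∈ Set.Ioo (0 : ℝ) 1) :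
    ∫⁻ ω, ((B.gmtOf (B.gmtParams α β γ)).T ω : ℝ≥0∞) ∂(B.P 0) ≤
      ENNReal.ofReal (B.gmtBound α β 0 (γ 0)) := by
  have hok := fun j => B.fixedOK_cStar (B.gmtErr_mem hα hβ (hγ 0) 0 j).1
    (B.gmtErr_mem hα hβ (hγ 0) 0 j).2
  refine lintegral_stages_le (B.P 0) (N := (B.gmtParams α β γ).N 0)
    (A := fun j => {ω | B.avgLLR ((B.gmtParams α β γ).N 0 j) ω ≤ (B.gmtParams α β γ).C 0 j})
    (fun j => measurableSet_le (B.measurable_avgLLR _) measurable_const)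
    (fun j hj ω h => B.gmtTime_le_of_accept hj h) (fun ω => B.gmtTime_le_last _ ω)
    (fun j => (inactiveErr_mem (hγ 0) hβ j).1.le) (fun j => ?_)
  refine (measure_mono fun ω hω => ?_).trans (hok j).1
  exact not_le.1 (show ¬ B.avgLLR ((B.gmtParams α β γ).N 0 j) ω ≤ (B.gmtParams α β γ).C 0 j from hω)

lemma lintegral_gmt_one_le {α β : ℝ} (hα : α ∈ Set.Ioo (0 : ℝ) 1) (hβ : β ∈ Set.Ioo (0 : ℝ) 1)
    {γ : Fin 2 → ℝ} (hγ : ∀ i, γ i ∈ Set.Ioo (0 : ℝ) 1) :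
    ∫⁻ ω, ((B.gmtOf (B.gmtParams α β γ)).T ω : ℝ≥0∞) ∂(B.P 1) ≤
      ENNReal.ofReal (B.gmtBound α β 1 (γ 1)) := by
  have hok := fun j => B.fixedOK_cStar (B.gmtErr_mem hα hβ (hγ 1) 1 j).1
    (B.gmtErr_mem hα hβ (hγ 1) 1 j).2
  refine lintegral_stages_le (B.P 1) (N := (B.gmtParams α β γ).N 1)
    (A := fun j => {ω | (B.gmtParams α β γ).C 1 j < B.avgLLR ((B.gmtParams α β γ).N 1 j) ω})
    (fun j => measurableSet_lt measurable_const (B.measurable_avgLLR _))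
    (fun j hj ω h => B.gmtTime_le_of_reject hj h) (fun ω => B.gmtTime_le_last _ ω)
    (fun j => (inactiveErr_mem (hγ 1) hα j).1.le) (fun j => ?_)
  refine (measure_mono fun ω hω => ?_).trans (hok j).2
  exact not_lt.1 (show ¬ (B.gmtParams α β γ).C 1 j < B.avgLLR ((B.gmtParams α β γ).N 1 j) ω from hω)

end BinaryProblem

/-! ### Asymptotics of the bound on the expected sample size -/

/-- The bound on the expected sample size of a multistage design, for an arbitrary function `n` in
the role of the sample size of the fixed-sample-size test. -/
def stageBound (n : ℝ → ℝ → ℕ) (K : ℕ) (α β γ : ℝ) : ℝ :=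
  n (inactiveErr γ β 0) (activeErr β K 0) +
    ∑ j ∈ Finset.Icc 1 K,
      (n (inactiveErr γ β j) (activeErr β K j) : ℝ) * inactiveErr γ β (j - 1) +
    (n (α / 4) (β / 4) : ℝ) * inactiveErr γ β K

/-- Since `j + 2 ≤ 2 ^ (j + 1)`, the linear factors only turn the ratio `β / 4` of the geometric
series into `β / 2`. -/
lemma sum_succ_mul_inactiveErr_le {β γ : ℝ} (hβ : β ∈ Set.Ioo (0 : ℝ) 1) (K : ℕ) :
    ∑ j ∈ Finset.range (K + 1), ((j : ℝ) + 1) * inactiveErr γ β j ≤ γ + β := by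
  have h1 : ∑ j ∈ Finset.range K, (((j + 1 : ℕ) : ℝ) + 1) * inactiveErr γ β (j + 1) ≤
      ∑ k ∈ Finset.Icc 1 K, (β / 2) ^ k := by
    rw [← Finset.Ico_add_one_right_eq_Icc, Finset.sum_Ico_eq_sum_range, Nat.add_sub_cancel]
    refine Finset.sum_le_sum fun j _ => ?_
    rw [inactiveErr, if_neg j.succ_ne_zero, add_comm 1 j,
      show β / 2 = 2 * (β / 4) by ring, mul_pow]
    have h2 : ((j + 1 : ℕ) : ℝ) + 1 ≤ 2 ^ (j + 1) := by
      exact_mod_cast Nat.lt_two_pow_self (n := j + 1)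
    exact mul_le_mul_of_nonneg_right h2 (pow_nonneg (by linarith [hβ.1]) _)
  have h3 := sum_Icc_pow_le (y := β / 2) (by linarith [hβ.1]) (by linarith [hβ.2]) K
  have h4 : β / 2 / (1 - β / 2) ≤ β := by
    rw [div_le_iff₀ (by linarith [hβ.2])]
    nlinarith [hβ.1, hβ.2]
  rw [Finset.sum_range_succ']
  have h5 : (((0 : ℕ) : ℝ) + 1) * inactiveErr γ β 0 = γ := by simp [inactiveErr]
  linarith

lemma sum_Icc_mul_pred (f : ℕ → ℝ) (K : ℕ) :
    ∑ j ∈ Finset.Icc 1 K, (j : ℝ) * f (j - 1) = ∑ j ∈ Finset.range K, ((j : ℝ) + 1) * f j := by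
  rw [← Finset.Ico_add_one_right_eq_Icc, Finset.sum_Ico_eq_sum_range, Nat.add_sub_cancel]
  refine Finset.sum_congr rfl fun j _ => ?_
  rw [Nat.add_sub_cancel_left]
  push_cast
  ring

lemma abs_log_of_mem {x : ℝ} (hx : x ∈ Set.Ioo (0 : ℝ) 1) : |Real.log x| = -Real.log x :=
  abs_of_neg (Real.log_neg hx.1 hx.2)

lemma abs_log_activeErr_le {β : ℝ} (hβ : β ∈ Set.Ioo (0 : ℝ) 1) (K : ℕ) :
    |Real.log (activeErr β K 0)| ≤ |Real.log β| + 3 := by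
  have hmem := activeErr_mem hβ K 0
  have hge := activeErr_zero_ge hβ K
  have h0 : 0 < 5 * β / 12 := by linarith [hβ.1]
  have h1 := Real.log_le_log h0 hge
  rw [show 5 * β / 12 = 5 / 12 * β by ring, Real.log_mul (by norm_num) hβ.1.ne'] at h1
  have h2 := Real.one_sub_inv_le_log_of_pos (show (0 : ℝ) < 5 / 12 by norm_num)
  rw [abs_log_of_mem hmem, abs_log_of_mem hβ]
  norm_num at h2
  linarith

/-- The first stage carries the main term. All other sample sizes, including the last, grow at most
linearly in the index, in units of `|log β|`, while their weights decay geometrically. The resulting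
bound is free of `K` and `α`. -/
lemma stageBound_le {n : ℝ → ℝ → ℕ} {I r : ℝ} (hI : 0 < I) (hr : 0 < r)
    (hn : ∀ a ∈ Set.Ioo (0 : ℝ) 1, ∀ b ∈ Set.Ioo (0 : ℝ) 1,
      (n a b : ℝ) ≤ max (|Real.log b| / I) (|Real.log a| / r) + 1)
    {K : ℕ} {α β γ : ℝ} (hα : α ∈ Set.Ioo (0 : ℝ) 1) (hβ : β ∈ Set.Ioo (0 : ℝ) 1)
    (hγ : γ ∈ Set.Ioo (0 : ℝ) 1)
    (hK : n (α / 4) (β / 4) < n ((β / 4) ^ (K + 1)) ((β / 4) ^ (K + 1)) ∨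
      (β / 4) ^ (K + 1) < 3 * α / 4) :
    stageBound n K α β γ ≤ max ((|Real.log β| + 3) / I) (|Real.log γ| / r) + 1 +
      (2 * (1 / I + 1 / r) + 1) * (|Real.log β| + 3) * (γ + β) := by
  set C := 1 / I + 1 / r with hC
  have hC0 : 0 < C := by positivity
  set x := β / 4 with hx
  set ℓ := -Real.log x with hℓ
  have hx01 : x ∈ Set.Ioo (0 : ℝ) 1 := ⟨by linarith [hβ.1], by linarith [hβ.2]⟩
  have hlog4 : 1 ≤ Real.log 4 := by
    rw [Real.le_log_iff_exp_le (by norm_num)]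
    linarith [Real.exp_one_lt_d9]
  have hlog4' : Real.log 4 ≤ 3 := by
    have := Real.log_le_sub_one_of_pos (show (0 : ℝ) < 4 by norm_num)
    linarith
  have hlog34 : Real.log 3 ≤ Real.log 4 := Real.log_le_log (by norm_num) (by norm_num)
  have hℓβ : ℓ = |Real.log β| + Real.log 4 := by
    rw [hℓ, hx, Real.log_div hβ.1.ne' (by norm_num), abs_log_of_mem hβ]
    ring
  have hℓ1 : Real.log 4 ≤ ℓ := by rw [hℓβ]; linarith [abs_nonneg (Real.log β)]
  have hlogpow : ∀ j : ℕ, |Real.log (x ^ j)| = j * ℓ := fun j => by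
    rw [Real.log_pow, abs_mul, abs_log_of_mem hx01, Nat.abs_cast]
  have hcrude : ∀ a ∈ Set.Ioo (0 : ℝ) 1, ∀ b ∈ Set.Ioo (0 : ℝ) 1, ∀ m : ℝ, |Real.log a| ≤ m →
      |Real.log b| ≤ m → (n a b : ℝ) ≤ C * m + 1 := by
    intro a ha b hb m ham hbm
    have hm : 0 ≤ m := (abs_nonneg _).trans ham
    refine (hn a ha b hb).trans (add_le_add_left (max_le ?_ ?_) _)
    · calc |Real.log b| / I ≤ m / I := by gcongr
        _ ≤ C * m := by
          rw [hC, add_mul, one_div_mul_eq_div]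
          linarith [mul_nonneg (one_div_pos.2 hr).le hm]
    · calc |Real.log a| / r ≤ m / r := by gcongr
        _ ≤ C * m := by
          rw [hC, add_mul, one_div_mul_eq_div, one_div_mul_eq_div]
          linarith [div_nonneg hm hI.le]
  have hpow : ∀ j : ℕ, 1 ≤ j → (n (x ^ j) (x ^ j) : ℝ) ≤ (2 * C + 1) * ℓ * j := by
    intro j hj
    have hmem := div_four_pow_mem hβ (j := j) (by omega)
    have h := hcrude _ hmem _ hmem (j * ℓ) (hlogpow j).le (hlogpow j).le
    have hj' : (1 : ℝ) ≤ j := Nat.one_le_cast.2 hj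
    have h2 : 1 ≤ j * ℓ := by nlinarith
    nlinarith [mul_pos hC0 (by linarith : 0 < j * ℓ)]
  -- Maximality of `K`: either the next opportunity would be longer than the last stage, or `x ^ (K
  -- + 1) < 3 * α / 4`, so that `|log (α / 4)|` is at most `(K + 1) * ℓ + log 3`, and `log 3 ≤ ℓ`.
  have hlast : (n (α / 4) x : ℝ) ≤ (2 * C + 1) * ℓ * (K + 1) := by
    rcases hK with h | h
    · have := hpow (K + 1) (by omega)
      push_cast at this
      exact (Nat.cast_le.2 h.le).trans this
    · have hα4 : α / 4 ∈ Set.Ioo (0 : ℝ) 1 := ⟨by linarith [hα.1], by linarith [hα.2]⟩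
      have hlog : |Real.log (α / 4)| ≤ 2 * ((K + 1) * ℓ) := by
        have hp : 0 < x ^ (K + 1) := pow_pos hx01.1 _
        have h1 := Real.log_le_log (by positivity) (show x ^ (K + 1) / 3 ≤ α / 4 by linarith)
        rw [Real.log_div hp.ne' (by norm_num), Real.log_pow] at h1
        push_cast at h1
        rw [abs_log_of_mem hα4]
        have hKℓ : ℓ ≤ (K + 1) * ℓ := by
          have : (0 : ℝ) ≤ K * ℓ := mul_nonneg (Nat.cast_nonneg _) (by linarith)
          linarith
        have h2 : (K + 1) * Real.log x = -((K + 1) * ℓ) := by rw [hℓ]; ring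
        linarith
      have hKℓ : 1 ≤ (K + 1) * ℓ := by
        have : (0 : ℝ) ≤ K * ℓ := mul_nonneg (Nat.cast_nonneg _) (by linarith)
        linarith
      have hlx : |Real.log x| ≤ 2 * ((K + 1) * ℓ) := by
        rw [abs_log_of_mem hx01, ← hℓ]
        have : (0 : ℝ) ≤ K * ℓ := mul_nonneg (Nat.cast_nonneg _) (by linarith)
        linarith
      have := hcrude _ hα4 _ hx01 _ hlog hlx
      nlinarith
  have hfirst : (n (inactiveErr γ β 0) (activeErr β K 0) : ℝ) ≤
      max ((|Real.log β| + 3) / I) (|Real.log γ| / r) + 1 := by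
    have h := hn _ (inactiveErr_mem hγ hβ 0) _ (activeErr_mem hβ K 0)
    refine h.trans (add_le_add_left (max_le_max ?_ ?_) _)
    · gcongr
      exact abs_log_activeErr_le hβ K
    · simp [inactiveErr]
  have hg : ∀ j, 0 ≤ inactiveErr γ β j := fun j => (inactiveErr_mem hγ hβ j).1.le
  have hmid : ∑ j ∈ Finset.Icc 1 K,
      (n (inactiveErr γ β j) (activeErr β K j) : ℝ) * inactiveErr γ β (j - 1) ≤
      (2 * C + 1) * ℓ * ∑ j ∈ Finset.range K, ((j : ℝ) + 1) * inactiveErr γ β j := by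
    rw [← sum_Icc_mul_pred (inactiveErr γ β) K, Finset.mul_sum]
    refine Finset.sum_le_sum fun j hj => ?_
    have hj1 := (Finset.mem_Icc.1 hj).1
    rw [inactiveErr, activeErr, if_neg (by omega), if_neg (by omega), ← mul_assoc]
    exact mul_le_mul_of_nonneg_right (hpow j hj1) (hg _)
  have hend : (n (α / 4) x : ℝ) * inactiveErr γ β K ≤
      (2 * C + 1) * ℓ * (((K : ℝ) + 1) * inactiveErr γ β K) := by
    rw [← mul_assoc]
    exact mul_le_mul_of_nonneg_right hlast (hg K)
  have hsum := sum_succ_mul_inactiveErr_le (γ := γ) hβ K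
  rw [Finset.sum_range_succ] at hsum
  have hfac : 0 ≤ (2 * C + 1) * ℓ := mul_nonneg (by linarith) (by linarith)
  have htot : (2 * C + 1) * ℓ * ∑ j ∈ Finset.range K, ((j : ℝ) + 1) * inactiveErr γ β j +
      (2 * C + 1) * ℓ * (((K : ℝ) + 1) * inactiveErr γ β K) ≤
      (2 * C + 1) * (|Real.log β| + 3) * (γ + β) := by
    rw [← mul_add]
    refine (mul_le_mul_of_nonneg_left hsum hfac).trans ?_
    have : 0 ≤ γ + β := by linarith [hγ.1, hβ.1]
    gcongr
    rw [hℓβ]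
    linarith
  rw [stageBound]
  linarith

/-- If the sample size of the fixed-sample-size test obeys Stein-type bounds with exponents
arbitrarily close to `I`, then the bound on the expected sample size is asymptotically at most
`|log β| / I`. -/
lemma exists_stageBound_le {n : ℝ → ℝ → ℕ} {I : ℝ} (hI : 0 < I)
    (hn : ∀ δ, 0 < δ → δ < I → ∃ r, 0 < r ∧ ∀ a ∈ Set.Ioo (0 : ℝ) 1, ∀ b ∈ Set.Ioo (0 : ℝ) 1,
      (n a b : ℝ) ≤ max (|Real.log b| / (I - δ)) (|Real.log a| / r) + 1)
    {K : ℝ → ℝ → ℕ} (hK : ∀ α ∈ Set.Ioo (0 : ℝ) 1, ∀ β ∈ Set.Ioo (0 : ℝ) 1,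
      n (α / 4) (β / 4) < n ((β / 4) ^ (K α β + 1)) ((β / 4) ^ (K α β + 1)) ∨
      (β / 4) ^ (K α β + 1) < 3 * α / 4) {η : ℝ} (hη : 0 < η) :
    ∃ ε, 0 < ε ∧ ∀ α ∈ Set.Ioo (0 : ℝ) 1, ∀ β ∈ Set.Ioo (0 : ℝ) 1, ∀ γ ∈ Set.Ioo (0 : ℝ) 1,
      1 ≤ ε * |Real.log β| → γ + β ≤ ε → |Real.log γ| ≤ ε * |Real.log β| →
      stageBound n (K α β) α β γ ≤ (1 + η) * (|Real.log β| / I) := by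
  -- Half of the largest admissible loss: then `(1 + η) * (I - δ) = I + I * η / 2`, which leaves
  -- room for the remainder.
  set δ := I * (η / (1 + η)) / 2 with hδ
  have hη1 : η / (1 + η) < 1 := by rw [div_lt_one (by linarith)]; linarith
  have hη0 : 0 < η / (1 + η) := by positivity
  have hδ0 : 0 < δ := by positivity
  have hδI : δ < I := by nlinarith
  have hI' : 0 < I - δ := by linarith
  obtain ⟨r, hr, hnr⟩ := hn δ hδ0 hδI
  set C := 2 * (1 / (I - δ) + 1 / r) + 1 with hC
  have hC0 : 0 < C := by positivity
  -- After division by `|log β|` the bound is a continuous function of `ε`; the strict inequality at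
  -- 0 persists for small `ε`.
  have hlt : max ((1 + 3 * 0) / (I - δ)) (0 / r) + 0 + C * (1 + 3 * 0) * 0 < (1 + η) / I := by
    have h1 : (0 : ℝ) ≤ 1 / (I - δ) := by positivity
    simp only [mul_zero, add_zero, zero_div, max_eq_left h1]
    rw [div_lt_div_iff₀ hI' hI]
    have : (1 + η) * δ = I * η / 2 := by rw [hδ]; field_simp
    nlinarith
  have hcont : Continuous fun ε : ℝ =>
      max ((1 + 3 * ε) / (I - δ)) (ε / r) + ε + C * (1 + 3 * ε) * ε := by fun_prop
  have hev := (hcont.tendsto 0).eventually (gt_mem_nhds hlt)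
  obtain ⟨ε, hε, hε0⟩ := ((hev.filter_mono (nhdsWithin_le_nhds (s := Set.Ioi 0))).and
    self_mem_nhdsWithin).exists
  have hε0 : 0 < ε := hε0
  refine ⟨ε, hε0, fun α hα β hβ γ hγ h1 h2 h3 => ?_⟩
  refine (stageBound_le hI' hr hnr hα hβ hγ (hK α hα β hβ)).trans ?_
  set L := |Real.log β| with hL
  have hL0 : 0 ≤ L := abs_nonneg _
  have hA : max ((L + 3) / (I - δ)) (|Real.log γ| / r) ≤
      max ((1 + 3 * ε) / (I - δ)) (ε / r) * L := by
    rw [max_mul_of_nonneg _ _ hL0]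
    refine max_le_max ?_ ?_
    · rw [div_mul_eq_mul_div]
      gcongr
      linarith
    · rw [div_mul_eq_mul_div]
      gcongr
  have hB : C * (L + 3) * (γ + β) ≤ C * ((1 + 3 * ε) * L) * ε := by
    have : 0 ≤ γ + β := by linarith [hγ.1, hβ.1]
    gcongr
    linarith
  calc _ ≤ max ((1 + 3 * ε) / (I - δ)) (ε / r) * L + ε * L + C * ((1 + 3 * ε) * L) * ε :=
        add_le_add (add_le_add hA h1) hB
    _ = (max ((1 + 3 * ε) / (I - δ)) (ε / r) + ε + C * (1 + 3 * ε) * ε) * L := by ring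
    _ ≤ (1 + η) / I * L := by gcongr
    _ = _ := by ring

/-- A bound that is asymptotically at most `|log β| / I` for parameters vanishing slowly satisfies
this for every selection by minimization. -/
lemma eventually_bound_le {U : ℝ → ℝ → ℝ → ℝ} {I η : ℝ}
    (hU : ∃ ε, 0 < ε ∧ ∀ α ∈ Set.Ioo (0 : ℝ) 1, ∀ β ∈ Set.Ioo (0 : ℝ) 1, ∀ γ ∈ Set.Ioo (0 : ℝ) 1,
      1 ≤ ε * |Real.log β| → γ + β ≤ ε → |Real.log γ| ≤ ε * |Real.log β| →
      U α β γ ≤ (1 + η) * (|Real.log β| / I)) {g : ℝ → ℝ → ℝ}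
    (hg : ∀ α ∈ Set.Ioo (0 : ℝ) 1, ∀ β ∈ Set.Ioo (0 : ℝ) 1, g α β ∈ Set.Ioo (0 : ℝ) 1)
    (hmin : ∀ ε, 0 < ε → ∀ᶠ q : ℝ × ℝ in 𝓝[>] (0 : ℝ) ×ˢ 𝓝[>] (0 : ℝ),
      ¬ IsMinOn (U q.1 q.2) (Set.Ioo (max (3 * q.1) q.2 / 4) 1) (g q.1 q.2) →
      g q.1 q.2 < ε ∧ |Real.log (g q.1 q.2)| ≤ ε * |Real.log q.2|) :
    ∀ᶠ q : ℝ × ℝ in 𝓝[>] (0 : ℝ) ×ˢ 𝓝[>] (0 : ℝ),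
      U q.1 q.2 (g q.1 q.2) ≤ (1 + η) * (|Real.log q.2| / I) := by
  obtain ⟨ε, hε, hU⟩ := hU
  have hfst : Tendsto (fun q : ℝ × ℝ => q.1) (𝓝[>] (0 : ℝ) ×ˢ 𝓝[>] (0 : ℝ)) (𝓝[>] 0) := tendsto_fst
  have hsnd : Tendsto (fun q : ℝ × ℝ => q.2) (𝓝[>] (0 : ℝ) ×ˢ 𝓝[>] (0 : ℝ)) (𝓝[>] 0) := tendsto_snd
  have hL := BinaryProblem.tendsto_abs_log.comp hsnd
  have hsmall : ∀ c : ℝ, 0 < c → ∀ᶠ x : ℝ in 𝓝[>] 0, x < c := fun c hc =>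
    nhdsWithin_le_nhds (gt_mem_nhds hc)
  have hloglog : ∀ᶠ L : ℝ in atTop, Real.log L ≤ ε * L := by
    filter_upwards [Real.isLittleO_log_id_atTop.bound hε, eventually_ge_atTop 1] with L hL hL1
    rw [Real.norm_eq_abs, Real.norm_eq_abs, id, abs_of_nonneg (by linarith : 0 ≤ L)] at hL
    exact (le_abs_self _).trans hL
  filter_upwards [hmin (ε / 2) (half_pos hε), hfst.eventually self_mem_nhdsWithin,
    hsnd.eventually self_mem_nhdsWithin, hfst.eventually (hsmall 1 one_pos),
    hsnd.eventually (hsmall 1 one_pos), hfst.eventually (hsmall (ε / 4) (by linarith)),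
    hsnd.eventually (hsmall (ε / 2) (by linarith)), hL.eventually (eventually_ge_atTop (4 / ε)),
    hL.eventually (eventually_gt_atTop 1), hL.eventually hloglog]
    with q hq h10 h20 h11 h21 h1ε h2ε hLε hL1 hLL
  simp only [Function.comp_apply] at hLε hL1 hLL
  have hα : q.1 ∈ Set.Ioo (0 : ℝ) 1 := ⟨h10, h11⟩
  have hβ : q.2 ∈ Set.Ioo (0 : ℝ) 1 := ⟨h20, h21⟩
  set L := |Real.log q.2| with hLdef
  have hL0 : 0 < L := by linarith
  have hL4 : 4 ≤ ε * L := by rwa [div_le_iff₀' hε] at hLε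
  by_cases hmin : IsMinOn (U q.1 q.2) (Set.Ioo (max (3 * q.1) q.2 / 4) 1) (g q.1 q.2)
  -- A competitor for the minimizer. It lies in the range because `3 * α / 4 < α` and `β * |log β| <
  -- 1`, it vanishes, and `|log γ| ≤ log L` is negligible relative to `L`.
  · set γ := max q.1 (1 / L) with hγ
    have hγ1 : q.1 ≤ γ := le_max_left _ _
    have hγL : 1 / L ≤ γ := le_max_right _ _
    have hγlt : γ < 1 := max_lt h11 (by rw [div_lt_one hL0]; exact hL1)
    have hγ0 : 0 < γ := hα.1.trans_le hγ1
    have hβL : q.2 / 4 < 1 / L := by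
      rw [lt_div_iff₀ hL0, hLdef, abs_log_of_mem hβ]
      have := Real.one_sub_inv_le_log_of_pos hβ.1
      have h2 : q.2 * q.2⁻¹ = 1 := mul_inv_cancel₀ hβ.1.ne'
      nlinarith [hβ.1, mul_le_mul_of_nonneg_left this hβ.1.le]
    have hmem : γ ∈ Set.Ioo (max (3 * q.1) q.2 / 4) 1 := by
      refine ⟨?_, hγlt⟩
      rw [div_lt_iff₀ (by norm_num)]
      exact max_lt (by linarith [hα.1]) (by linarith)
    refine (hmin hmem).trans (hU _ hα _ hβ γ ⟨hγ0, hγlt⟩ (by linarith) ?_ ?_)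
    · have h1L : 1 / L ≤ ε / 4 := by
        rw [div_le_iff₀ hL0]
        linarith
      have : γ ≤ ε / 4 := max_le h1ε.le h1L
      linarith
    · rw [abs_log_of_mem ⟨hγ0, hγlt⟩]
      have := Real.log_le_log (by positivity) hγL
      rw [one_div, Real.log_inv] at this
      linarith
  · obtain ⟨h1, h2⟩ := hq hmin
    refine hU _ hα _ hβ _ (hg _ hα _ hβ) (by linarith) (by linarith) (h2.trans ?_)
    gcongr
    linarith

/-! ### Application to the General Multistage Test -/

namespace BinaryProblem

variable {𝒳 : Type*} [MeasurableSpace 𝒳] (B : BinaryProblem 𝒳)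

lemma gmtBound_zero (α β γ : ℝ) :
    B.gmtBound α β 0 γ = stageBound B.nStar (B.gmtK α β 0) α β γ := by
  simp [gmtBound, stageBound, gmtErr]

lemma gmtBound_one (α β γ : ℝ) : B.gmtBound α β 1 γ =
    stageBound (fun a b => B.nStar b a) (B.gmtK α β 1) β α γ := by
  simp [gmtBound, stageBound, gmtErr]

/-- The powers tend to 0, so the set is bounded and `sSup` is not a default value. -/
lemma succ_sSup_notMem {p : ℕ → Prop} {x y : ℝ} (hx : x ∈ Set.Ioo (0 : ℝ) 1) (hy : 0 < y)
    (S : Set ℕ) (hS : S = {j | p j ∧ 3 * y / 4 ≤ (x / 4) ^ j}) :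
    ¬ p (sSup S + 1) ∨ (x / 4) ^ (sSup S + 1) < 3 * y / 4 := by
  by_contra! h
  have hmem : sSup S + 1 ∈ S := by rw [hS] at h ⊢; exact h
  have h0 : 0 ≤ x / 4 := by linarith [hx.1]
  have h1 : x / 4 < 1 := by linarith [hx.2]
  obtain ⟨k, hk⟩ := exists_pow_lt_of_lt_one (show 0 < 3 * y / 4 by linarith) h1
  have hbdd : BddAbove S := by
    refine ⟨k, fun j hj => ?_⟩
    rw [hS] at hj
    by_contra hlt
    exact absurd (hj.2.trans (pow_le_pow_of_le_one h0 h1.le (not_le.1 hlt).le)) (not_le.2 hk)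
  have := le_csSup hbdd hmem
  omega

lemma gmtK_zero_spec {α β : ℝ} (hα : α ∈ Set.Ioo (0 : ℝ) 1) (hβ : β ∈ Set.Ioo (0 : ℝ) 1) :
    B.nStar (α / 4) (β / 4) <
      B.nStar ((β / 4) ^ (B.gmtK α β 0 + 1)) ((β / 4) ^ (B.gmtK α β 0 + 1)) ∨
      (β / 4) ^ (B.gmtK α β 0 + 1) < 3 * α / 4 :=
  (succ_sSup_notMem (p := fun j =>
    B.nStar ((β / 4) ^ j) ((β / 4) ^ j) ≤ B.nStar (α / 4) (β / 4)) hβ hα.1 _ rfl).imp_left not_le.1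

lemma gmtK_one_spec {α β : ℝ} (hα : α ∈ Set.Ioo (0 : ℝ) 1) (hβ : β ∈ Set.Ioo (0 : ℝ) 1) :
    B.nStar (α / 4) (β / 4) <
      B.nStar ((α / 4) ^ (B.gmtK α β 1 + 1)) ((α / 4) ^ (B.gmtK α β 1 + 1)) ∨
      (α / 4) ^ (B.gmtK α β 1 + 1) < 3 * β / 4 :=
  (succ_sSup_notMem (p := fun j =>
    B.nStar ((α / 4) ^ j) ((α / 4) ^ j) ≤ B.nStar (α / 4) (β / 4)) hα hβ.1 _ rfl).imp_left not_le.1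

lemma GMTSelection.eventually {B : BinaryProblem 𝒳} {i : Fin 2} {γ : ℝ → ℝ → ℝ}
    (h : B.GMTSelection i γ) {ε : ℝ} (hε : 0 < ε) :
    ∀ᶠ q : ℝ × ℝ in 𝓝[>] (0 : ℝ) ×ˢ 𝓝[>] (0 : ℝ),
      ¬ IsMinOn (B.gmtBound q.1 q.2 i) (gmtRange q.1 q.2 i) (γ q.1 q.2) →
      γ q.1 q.2 < ε ∧
        |Real.log (γ q.1 q.2)| ≤ ε * |Real.log (if i = 0 then q.2 else q.1)| := by
  have h1 := eventually_inf_principal.1 (h.2.1.eventually (gt_mem_nhds hε))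
  have h2 := eventually_inf_principal.1 (h.2.2.eventually (gt_mem_nhds hε))
  have hpos : ∀ᶠ q : ℝ × ℝ in 𝓝[>] (0 : ℝ) ×ˢ 𝓝[>] (0 : ℝ),
      0 < |Real.log (if i = 0 then q.2 else q.1)| := by
    split_ifs
    · exact (tendsto_abs_log.comp tendsto_snd).eventually (eventually_gt_atTop 0)
    · exact (tendsto_abs_log.comp tendsto_fst).eventually (eventually_gt_atTop 0)
  filter_upwards [h1, h2, hpos] with q hq1 hq2 hq hmin
  exact ⟨hq1 hmin, (div_le_iff₀ hq).1 (hq2 hmin).le⟩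

lemma eventually_gmtBound_zero {γ : ℝ → ℝ → ℝ} (h : B.GMTSelection 0 γ) {η : ℝ} (hη : 0 < η) :
    ∀ᶠ q : ℝ × ℝ in 𝓝[>] (0 : ℝ) ×ˢ 𝓝[>] (0 : ℝ),
      B.gmtBound q.1 q.2 0 (γ q.1 q.2) ≤ (1 + η) * (|Real.log q.2| / B.info) := by
  refine eventually_bound_le (U := fun α β => B.gmtBound α β 0) (g := γ) ?_
    (fun α hα β hβ => gmtRange_subset hα.1 0 (h.1 α hα β hβ)) (fun ε hε => ?_)
  · simp only [gmtBound_zero]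
    refine exists_stageBound_le B.info_pos (fun δ h0 h1 => ?_)
      (K := fun α β => B.gmtK α β 0) (fun α hα β hβ => B.gmtK_zero_spec hα hβ) hη
    obtain ⟨r, hr, hn⟩ := B.exists_nStar_le_zero h0 h1
    exact ⟨r, hr, fun a ha b hb => (hn a ha b hb).2⟩
  · exact h.eventually hε

lemma eventually_gmtBound_one {γ : ℝ → ℝ → ℝ} (h : B.GMTSelection 1 γ) {η : ℝ} (hη : 0 < η) :
    ∀ᶠ q : ℝ × ℝ in 𝓝[>] (0 : ℝ) ×ˢ 𝓝[>] (0 : ℝ),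
      B.gmtBound q.1 q.2 1 (γ q.1 q.2) ≤ (1 + η) * (|Real.log q.1| / B.swap.info) := by
  -- The general bound with the levels exchanged; the range for `i = 1` then matches up to the order
  -- inside the maximum.
  have key := eventually_bound_le (U := fun β α => B.gmtBound α β 1) (g := fun β α => γ α β)
    (I := B.swap.info) (η := η) ?_
    (fun β hβ α hα => gmtRange_subset hα.1 1 (h.1 α hα β hβ)) (fun ε hε => ?_)
  · exact tendsto_prod_swap.eventually key
  · simp only [gmtBound_one]
    refine exists_stageBound_le (n := fun a b => B.nStar b a) B.swap.info_pos (fun δ h0 h1 => ?_)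
      (K := fun β α => B.gmtK α β 1) (fun β hβ α hα => B.gmtK_one_spec hα hβ) hη
    obtain ⟨r, hr, hn⟩ := B.exists_nStar_le_one h0 h1
    exact ⟨r, hr, fun a ha b hb => hn b hb a ha⟩
  · filter_upwards [tendsto_prod_swap.eventually (h.eventually hε)] with q hq hmin
    refine hq fun hm => hmin ?_
    rw [gmtRange, if_neg one_ne_zero] at hm
    rw [max_comm]
    exact hm

end BinaryProblem

end

/-! ### The main theorem -/

theorem mainTheorem3 {𝒳 : Type*} [MeasurableSpace 𝒳] (B : BinaryProblem 𝒳) (l u : ℕ → ℕ)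
    (hlu : ∀ m : ℕ, 1 ≤ m → l m ≤ u m ∧ u m ≤ m ∧ 0 < u m ∧ l m < m)
    (hu : Tendsto u atTop atTop) (hl : Tendsto (fun m : ℕ => m - l m) atTop atTop) :
    (∀ m : ℕ, 1 ≤ m →
      (∀ α ∈ Set.Ioo (0 : ℝ) 1, ∀ β ∈ Set.Ioo (0 : ℝ) 1,
        B.fweClass m (l m) (u m) α β = B.testClass (levelI m (l m) α) (levelII (u m) β)) ∧
      ∀ (τ : TestRule 𝒳), B.IsTest τ → ∀ A : Finset (Fin m),
        B.avgESS A τ = B.ess ((A.card : ℝ) / m) τ) ∧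
    B.HighDimOptimal l u B.sprt ∧
    ∀ γ : Fin 2 → ℝ → ℝ → ℝ, (∀ i, B.GMTSelection i (γ i)) →
      B.HighDimOptimal l u (B.gmt γ) := by
  refine ⟨fun m hm => ⟨fun α hα β hβ => ?_, fun τ hτ A => B.avgESS_eq_ess hm hτ A⟩, ?_,
    fun γ hγ => ?_⟩
  · obtain ⟨h1, h2, h3, h4⟩ := hlu m hm
    exact B.fweClass_eq_testClass h1 h2 h3 h4 hα hβ
  · exact B.highDimOptimal_of_eventually hlu hu hl
      (fun α hα β hβ => B.sprt_mem_testClass hα hβ)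
      (fun η hη => B.eventually_sprt_zero hη) (fun η hη => B.eventually_sprt_one hη)
  · have hmem : ∀ α ∈ Set.Ioo (0 : ℝ) 1, ∀ β ∈ Set.Ioo (0 : ℝ) 1, ∀ i, γ i α β ∈ Set.Ioo (0 : ℝ) 1 :=
      fun α hα β hβ i => BinaryProblem.gmtRange_subset hα.1 i ((hγ i).1 α hα β hβ)
    have hlevels : ∀ᶠ q : ℝ × ℝ in 𝓝[>] (0 : ℝ) ×ˢ 𝓝[>] (0 : ℝ),
        q.1 ∈ Set.Ioo (0 : ℝ) 1 ∧ q.2 ∈ Set.Ioo (0 : ℝ) 1 :=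
      prod_mem_prod (Ioo_mem_nhdsGT one_pos) (Ioo_mem_nhdsGT one_pos)
    refine B.highDimOptimal_of_eventually hlu hu hl
      (fun α hα β hβ => B.gmtOf_mem_testClass hα hβ (hmem α hα β hβ))
      (fun η hη => ?_) (fun η hη => ?_)
    · filter_upwards [hlevels, B.eventually_gmtBound_zero (hγ 0) hη] with q hq hb
      exact (B.lintegral_gmt_zero_le hq.1 hq.2 (hmem _ hq.1 _ hq.2)).trans
        (ENNReal.ofReal_le_ofReal hb)
    · filter_upwards [hlevels, B.eventually_gmtBound_one (hγ 1) hη] with q hq hb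
      exact (B.lintegral_gmt_one_le hq.1 hq.2 (hmem _ hq.1 _ hq.2)).trans
        (ENNReal.ofReal_le_ofReal hb)
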